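/- Let $2\le k\le\infty$ and let $M$ be a manifold of class $C^{k+1}$ and of finite dimension $n\ge 2$; "smooth" means of class $C^k$. Definitions. A (strong) cone in a real vector space $V$ of dimension $n$ is a non-empty smooth embedded hypersurface $\mathcal C_0\subset V\setminus\{0\}$ such that: (i) $v\in\mathcal C_0$, $\lambda>0$ imply $\lambda v\in\mathcal C_0$; (ii) $v\in\mathcal C_0$ implies $-v\notin\mathcal C_0$; (iii) $\mathcal C_0$ is the boundary in $V\setminus\{0\}$ of an open convex set $A_0\subset V\setminus\{0\}$ (its interior, which is unique); (iv) at each $v\in\mathcal C_0$ the second fundamental form of $\mathcal C_0$, as an affine hypersurface of $V$ and with respect to a transverse direction pointing into $A_0$, is positive semi-definite with radical $\mathbb R v$. A cone structure on $M$ is a smooth embedded hypersurface $\mathcal C\subset TM$ that is transverse to the fibres of $TM$, i.e. $T_v(T_pM)+T_v\mathcal C=T_v(TM)$ for all $v\in\mathcal C_p:=\mathcal C\cap T_pM$, and such that every $\mathcal C_p$ is a cone in $T_pM$; write $A_p$ for the interior of $\mathcal C_p$. A vector $v\in T_pM$ is timelike if $v\in A_p$ and causal if $v\in A_p\cup\mathcal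 C_p$. A smooth 1-form $\Omega$ is timelike if $\Omega(v)>0$ for every causal $v$; a smooth vector field $T$ is timelike if every $T_p$ is timelike, and $\Omega$-unit if $\Omega(T)\equiv 1$. If $\Omega(T)\equiv1$, let $\pi:TM\to\ker\Omega$, $\pi(v_p)=v_p-\Omega(v_p)T_p$. For a nowhere vanishing smooth $\Omega$, a Finsler metric on the vector bundle $\ker\Omega$ is a function $F:\ker\Omega\to[0,\infty)$ that is zero on the zero section and smooth and positive off it, satisfies $F(\lambda w)=\lambda F(w)$ for $\lambda>0$, and for which the fundamental tensor $g_w(u,u')=\frac12\,\frac{\partial^2}{\partial r\,\partial s}F(w+ru+su')^2\big|_{r=s=0}$ on $\ker\Omega_p$ is positive definite for all $w\in\ker\Omega_p\setminus\{0\}$, $p\in M$. A cone triple $(\Omega,T,F)$ consists of a nowhere vanishing smooth 1-form $\Omega$, a smooth vector field $T$ with $\Omega(T)\equiv1$, and a Finsler metric $F$ on $\ker\Omega$. Theorem. (1) Let $\mathcal C$ be a cone structure on $M$. For every timelike 1-form $\Omega$ and every $\Omega$-unit timelike vector field $T$ there is a unique Finsler metric $F$ on $\ker\Omega$ such that for all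 $p\in M$ and all $v_p\in T_pM\setminus\{0\}$ $$v_p\in\mathcal C\iff v_p=F(\pi(v_p))\,T_p+\pi(v_p).\qquad(*)$$ (2) Conversely, for every cone triple $(\Omega,T,F)$ on $M$ there is a unique cone structure $\mathcal C$ on $M$ that satisfies $(*)$ for all $p\in M$ and all $v_p\in T_pM\setminus\{0\}$. -/

import Mathlib

open Set Filter Topology Manifold Bundle
open scoped ContDiff

namespace ConeGeometry

section Hypersurface

variable {E : Type*} [NormedAddCommGroup E] [NormedSpace ℝ E]
  {H : Type*} [TopologicalSpace H] {N : Type*} [TopologicalSpace N] [ChartedSpace H N]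

/-- `f` is a `C^k` defining function of the subset `S` of the manifold `N` near the point `x`:
on some open neighbourhood `U` of `x` the function `f` is of class `C^k` and `S ∩ U` is its zero
set, and `df_x ≠ 0`. If `x ∈ S`, the tangent space of `S` at `x` is then `ker df_x`. -/
def IsDefiningFunctionAt (I : ModelWithCorners ℝ E H) (k : ℕ∞ω) (S : Set N) (f : N → ℝ) (x : N) :
    Prop :=
  (∃ U : Set N, IsOpen U ∧ x ∈ U ∧ ContMDiffOn I 𝓘(ℝ, ℝ) k f U ∧ ∀ y ∈ U, (y ∈ S ↔ f y = 0)) ∧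
    mfderiv I 𝓘(ℝ, ℝ) f x ≠ 0

/-- `S` is an embedded `C^k` hypersurface of `N`: near each of its points it is the regular zero
set of a real function of class `C^k`. It is not required to be closed. -/
def IsEmbeddedHypersurface (I : ModelWithCorners ℝ E H) (k : ℕ∞ω) (S : Set N) : Prop :=
  ∀ x ∈ S, ∃ f : N → ℝ, IsDefiningFunctionAt I k S f x

end Hypersurface

section VectorSpace

variable {V : Type*} [NormedAddCommGroup V] [NormedSpace ℝ V]

/-- `A` is an interior of the cone `C`: an open convex subset of `V ∖ {0}` whose boundary in
`V ∖ {0}` is `C`. -/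
structure IsConeInterior (C A : Set V) : Prop where
  isOpen : IsOpen A
  zero_notMem : (0 : V) ∉ A
  convex : Convex ℝ A
  boundary_eq : C = frontier A \ {0}

/-- The interior of a cone `C` (for a weak cone in dimension at least two there is exactly one set
`A` with `IsConeInterior C A`, and this is that set). -/
def coneInterior (C : Set V) : Set V := {v | ∃ A : Set V, IsConeInterior C A ∧ v ∈ A}

/-- Weak (and salient) cones of class `C^k` in the vector space `V`. -/
structure IsWeakCone (k : ℕ∞ω) (C : Set V) : Prop where
  nonempty : C.Nonempty
  zero_notMem : (0 : V) ∉ C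
  hypersurface : IsEmbeddedHypersurface 𝓘(ℝ, V) k C
  conic : ∀ v ∈ C, ∀ c : ℝ, 0 < c → c • v ∈ C
  salient : ∀ v ∈ C, -v ∉ C
  convex_interior : ∃ A : Set V, IsConeInterior C A

/-- The second fundamental form at `v`, with respect to the transverse vector `N`, of an affine
hypersurface `{f = 0}` of `V`: for vector fields `X`, `Y` tangent to it, the component along `N` of
the flat derivative `D_X Y` is `-D²f(X, Y) / df(N)` (differentiate `df(Y) = 0` along `X`). It does
not depend on the choice of the defining function `f`. -/
noncomputable def secondFundamentalForm (f : V → ℝ) (v N u w : V) : ℝ :=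
  -(fderiv ℝ (fderiv ℝ f) v u w) / fderiv ℝ f v N

/-- The second fundamental form of the hypersurface `C` of `V` at its point `v`, with respect to a
transverse vector `N` pointing out to `A`, is positive semi-definite on the tangent space `ker df_v`
and its radical is the radial direction `ℝ v`. Here `f` is a defining function of `C` near `v`;
the condition depends neither on `f` nor on `N`. -/
def IsStronglyConvexAt (k : ℕ∞ω) (C A : Set V) (v : V) : Prop :=
  ∃ (f : V → ℝ) (N : V), IsDefiningFunctionAt 𝓘(ℝ, V) k C f v ∧
    fderiv ℝ f v N ≠ 0 ∧ (∀ᶠ t in 𝓝[>] (0 : ℝ), v + t • N ∈ A) ∧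
    (∀ u : V, fderiv ℝ f v u = 0 → 0 ≤ secondFundamentalForm f v N u u) ∧
    ∀ u : V, fderiv ℝ f v u = 0 →
      ((∀ w : V, fderiv ℝ f v w = 0 → secondFundamentalForm f v N u w = 0) ↔
        ∃ c : ℝ, u = c • v)

/-- (Strong) cones of class `C^k` in the vector space `V`. -/
structure IsStrongCone (k : ℕ∞ω) (C : Set V) : Prop extends IsWeakCone k C where
  strongly_convex : ∀ v ∈ C, IsStronglyConvexAt k C (coneInterior C) v

end VectorSpace

section MinkowskiNorm

variable {W : Type*} [AddCommGroup W] [Module ℝ W]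

/-- The fundamental tensor `g_v(u, w) = ½ ∂²/∂r∂s L(v + r u + s w)|_{r = s = 0}`. -/
noncomputable def fundamentalTensor (L : W → ℝ) (v u w : W) : ℝ :=
  (1 / 2) * deriv (fun r : ℝ => deriv (fun s : ℝ => L (v + r • u + s • w)) 0) 0

/-- The algebraic conditions on a Minkowski norm, extended by `0` at the origin; smoothness is
required separately. -/
structure IsMinkowskiNorm (F : W → ℝ) : Prop where
  map_zero : F 0 = 0
  pos : ∀ v : W, v ≠ 0 → 0 < F v
  homogeneous : ∀ (c : ℝ) (v : W), 0 < c → F (c • v) = c * F v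
  posDef : ∀ v : W, v ≠ 0 → ∀ u : W, u ≠ 0 → 0 < fundamentalTensor (fun x => F x ^ 2) v u u

end MinkowskiNorm

section Manifold

variable {E : Type*} [NormedAddCommGroup E] [NormedSpace ℝ E]
  {M : Type*} [TopologicalSpace M] [ChartedSpace E M]

/-- The part `C_p = C ∩ T_pM` of a set of tangent vectors, as a subset of `T_pM = E`. -/
def coneFiber (C : Set (TangentBundle 𝓘(ℝ, E) M)) (p : M) : Set E :=
  {v | (⟨p, v⟩ : TangentBundle 𝓘(ℝ, E) M) ∈ C}

/-- The tangent space at `(p, w)` of the fibre `T_pM` of `TM`, as a subspace of `T_(p, w)(TM)`: the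
range of the differential of the inclusion of the fibre. -/
noncomputable def fiberTangentSpace [IsManifold 𝓘(ℝ, E) 1 M] (p : M) (w : E) :
    Submodule ℝ (TangentSpace 𝓘(ℝ, E).tangent (⟨p, w⟩ : TangentBundle 𝓘(ℝ, E) M)) :=
  LinearMap.range (mfderiv 𝓘(ℝ, E) 𝓘(ℝ, E).tangent
    (fun u : E => (⟨p, u⟩ : TangentBundle 𝓘(ℝ, E) M)) w).toLinearMap

/-- (Strong) cone structures of class `C^k`: embedded hypersurfaces `C` of `TM` that are transverse
to the fibres, `T_v(T_pM) + T_v C = T_v(TM)`, and meet each tangent space in a strong cone. -/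
structure IsConeStructure [IsManifold 𝓘(ℝ, E) 1 M] (k : ℕ∞ω)
    (C : Set (TangentBundle 𝓘(ℝ, E) M)) : Prop where
  hypersurface : IsEmbeddedHypersurface 𝓘(ℝ, E).tangent k C
  transverse : ∀ (p : M) (w : E), (⟨p, w⟩ : TangentBundle 𝓘(ℝ, E) M) ∈ C →
    ∃ f : TangentBundle 𝓘(ℝ, E) M → ℝ,
      IsDefiningFunctionAt 𝓘(ℝ, E).tangent k C f ⟨p, w⟩ ∧
        fiberTangentSpace p w ⊔
          LinearMap.ker (mfderiv 𝓘(ℝ, E).tangent 𝓘(ℝ, ℝ) f ⟨p, w⟩).toLinearMap = ⊤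
  strongCone : ∀ p : M, IsStrongCone k (coneFiber C p)

/-- Timelike tangent vectors: those in the cone domain. -/
def IsTimelikeVector (C : Set (TangentBundle 𝓘(ℝ, E) M)) (v : TangentBundle 𝓘(ℝ, E) M) : Prop :=
  v.snd ∈ coneInterior (coneFiber C v.proj)

/-- Causal tangent vectors: the timelike ones and those in `C` (the lightlike ones). -/
def IsCausalVector (C : Set (TangentBundle 𝓘(ℝ, E) M)) (v : TangentBundle 𝓘(ℝ, E) M) : Prop :=
  IsTimelikeVector C v ∨ v ∈ C

/-- `1`-forms of class `C^k`, as sections of the cotangent bundle. -/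
def IsContDiffOneForm [IsManifold 𝓘(ℝ, E) 1 M] (k : ℕ∞ω)
    (Ω : ∀ p : M, TangentSpace 𝓘(ℝ, E) p →L[ℝ] ℝ) : Prop :=
  ContMDiff 𝓘(ℝ, E) (𝓘(ℝ, E).prod 𝓘(ℝ, E →L[ℝ] ℝ)) k
    (fun p : M => TotalSpace.mk' (E →L[ℝ] ℝ)
      (E := fun q : M => TangentSpace 𝓘(ℝ, E) q →L[ℝ] Bundle.Trivial M ℝ q) p (Ω p))

/-- Vector fields of class `C^k`. -/
def IsContDiffVectorField [IsManifold 𝓘(ℝ, E) 1 M] (k : ℕ∞ω)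
    (T : ∀ p : M, TangentSpace 𝓘(ℝ, E) p) : Prop :=
  ContMDiff 𝓘(ℝ, E) 𝓘(ℝ, E).tangent k (fun p : M => (⟨p, T p⟩ : TangentBundle 𝓘(ℝ, E) M))

/-- Timelike `1`-forms of class `C^k`. -/
structure IsTimelikeOneForm [IsManifold 𝓘(ℝ, E) 1 M] (k : ℕ∞ω)
    (C : Set (TangentBundle 𝓘(ℝ, E) M)) (Ω : ∀ p : M, TangentSpace 𝓘(ℝ, E) p →L[ℝ] ℝ) :
    Prop where
  contDiff : IsContDiffOneForm k Ω
  pos : ∀ v : TangentBundle 𝓘(ℝ, E) M, IsCausalVector C v → 0 < Ω v.proj v.snd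

/-- Timelike vector fields of class `C^k`. -/
structure IsTimelikeVectorField [IsManifold 𝓘(ℝ, E) 1 M] (k : ℕ∞ω)
    (C : Set (TangentBundle 𝓘(ℝ, E) M)) (T : ∀ p : M, TangentSpace 𝓘(ℝ, E) p) : Prop where
  contDiff : IsContDiffVectorField k T
  timelike : ∀ p : M, IsTimelikeVector C ⟨p, T p⟩

/-- The fibre `ker Ω_p` of the vector bundle `ker Ω ⊆ TM`. -/
noncomputable abbrev kerFiber (Ω : ∀ p : M, TangentSpace 𝓘(ℝ, E) p →L[ℝ] ℝ) (p : M) :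
    Submodule ℝ (TangentSpace 𝓘(ℝ, E) p) :=
  LinearMap.ker (Ω p).toLinearMap

/-- The projection `π(v) = v - Ω(v) T_p` of `T_pM = span(T_p) ⊕ ker Ω_p` onto `ker Ω_p`, where
`Ω(T) = 1`. -/
noncomputable def kerProj (Ω : ∀ p : M, TangentSpace 𝓘(ℝ, E) p →L[ℝ] ℝ) (T : ∀ p : M, TangentSpace 𝓘(ℝ, E) p)
    (hT : ∀ p : M, Ω p (T p) = 1) (p : M) (v : TangentSpace 𝓘(ℝ, E) p) : kerFiber Ω p :=
  ⟨v - Ω p v • T p, by simp [hT p]⟩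

/-- Finsler metrics of class `C^k` on the vector bundle `ker Ω` (for a nowhere vanishing `Ω`): a
Minkowski norm on each fibre, such that the resulting function on `ker Ω ∖ 0`, a submanifold of
`TM`, is of class `C^k`, that is, extends locally to functions of class `C^k` on `TM`. -/
structure IsFinslerMetric [IsManifold 𝓘(ℝ, E) 1 M] (k : ℕ∞ω)
    (Ω : ∀ p : M, TangentSpace 𝓘(ℝ, E) p →L[ℝ] ℝ) (F : ∀ p : M, kerFiber Ω p → ℝ) : Prop where
  contDiff : ∀ (p : M) (w : kerFiber Ω p), w ≠ 0 →
    ∃ (U : Set (TangentBundle 𝓘(ℝ, E) M)) (G : TangentBundle 𝓘(ℝ, E) M → ℝ),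
      IsOpen U ∧ (⟨p, w⟩ : TangentBundle 𝓘(ℝ, E) M) ∈ U ∧
      ContMDiffOn 𝓘(ℝ, E).tangent 𝓘(ℝ, ℝ) k G U ∧
      ∀ (q : M) (x : kerFiber Ω q), (⟨q, x⟩ : TangentBundle 𝓘(ℝ, E) M) ∈ U → F q x = G ⟨q, x⟩
  minkowski : ∀ p : M, IsMinkowskiNorm (F p)

/-- Cone triples `(Ω, T, F)` of class `C^k`. -/
structure IsConeTriple [IsManifold 𝓘(ℝ, E) 1 M] (k : ℕ∞ω)
    (Ω : ∀ p : M, TangentSpace 𝓘(ℝ, E) p →L[ℝ] ℝ) (T : ∀ p : M, TangentSpace 𝓘(ℝ, E) p)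
    (F : ∀ p : M, kerFiber Ω p → ℝ) : Prop where
  contDiff_form : IsContDiffOneForm k Ω
  ne_zero : ∀ p : M, Ω p ≠ 0
  contDiff_field : IsContDiffVectorField k T
  unit : ∀ p : M, Ω p (T p) = 1
  finsler : IsFinslerMetric k Ω F

/-- For every `v ∈ TM ∖ 0`: `v ∈ C ↔ v = F(π(v)) T + π(v)`. -/
def IsAssociatedCone (Ω : ∀ p : M, TangentSpace 𝓘(ℝ, E) p →L[ℝ] ℝ)
    (T : ∀ p : M, TangentSpace 𝓘(ℝ, E) p) (hT : ∀ p : M, Ω p (T p) = 1)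
    (F : ∀ p : M, kerFiber Ω p → ℝ) (C : Set (TangentBundle 𝓘(ℝ, E) M)) : Prop :=
  ∀ (p : M) (v : TangentSpace 𝓘(ℝ, E) p), v ≠ 0 →
    ((⟨p, v⟩ : TangentBundle 𝓘(ℝ, E) M) ∈ C ↔
      v = F p (kerProj Ω T hT p v) • T p + (kerProj Ω T hT p v : TangentSpace 𝓘(ℝ, E) p))

end Manifold

end ConeGeometry

/-! Fix `p`. Causal vectors have `Ω > 0`, so the interior of `C_p` contains no ray tending to a
direction of `ker Ω_p`. A half line from `T_p` in such a direction therefore leaves the interior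
through `C_p`. After rescaling, every nonzero `w` in `ker Ω_p` has a `t` with `w + t T_p ∈ C_p`.
There is only one, because adding a positive multiple of `T_p` to a point of `C_p` lands in the
interior. Then `F w = t` is the only choice, and it is homogeneous because the cone is.

A vector of the interior is transverse to the cone (`IsDefiningFunctionAt.apply_ne_zero`), and the
cone structure is transverse to the fibres, so the implicit function theorem makes `F` of class
`C^k` (`IsConeStructure.exists_contMDiffOn`). With `g s = F (w + s u)`, the fundamental tensor is
`g'² + F g''`, and differentiating the equation of the cone twice shows that `g''` is a positive
multiple of the second fundamental form at `u + g' T`. Positivity follows, and equality would make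
`u + g' T` radial, hence `u = 0` (`fundamentalTensor_pos_of_isStronglyConvexAt`).

Conversely, the cone must be `Ω = F ∘ π` off the zero section. Pulled back along `π`, `F` becomes a
function `H` on `T_pM` whose Hessian off the line of `T_p` is positive semi-definite with radical
spanned by the base point and `T_p`. This yields the triangle inequality, so `H < Ω` is an open
convex cone, and the Hessian of `H` is the second fundamental form of its boundary
(`IsCylindricalNorm.isStrongCone`). The equation is regular along the fibres, which gives
transversality. -/

namespace ConeGeometry

/-! ### Implicit functions with a scalar unknown -/

section ImplicitFunction

variable {Y : Type*} [NormedAddCommGroup Y] [NormedSpace ℝ Y]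

theorem fderiv_comp_inr_isInvertible {f : Y × ℝ → ℝ} {z : Y × ℝ} (h : fderiv ℝ f z (0, 1) ≠ 0) :
    (fderiv ℝ f z ∘L .inr ℝ Y ℝ).IsInvertible := by
  refine ⟨ContinuousLinearEquiv.unitsEquivAut ℝ (Units.mk0 _ h), ?_⟩
  ext
  simp

/-- The implicit function theorem for a scalar unknown, with smoothness on a neighbourhood. -/
theorem exists_contDiffOn_implicit [CompleteSpace Y] {k : ℕ∞ω} (hk : 1 ≤ k) {f : Y × ℝ → ℝ}
    {W : Set (Y × ℝ)} (hW : IsOpen W) (hf : ContDiffOn ℝ k f W) {z : Y × ℝ} (hz : z ∈ W)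
    (hfz : f z = 0) (hd : fderiv ℝ f z (0, 1) ≠ 0) :
    ∃ (V : Set Y) (g : Y → ℝ), IsOpen V ∧ z.1 ∈ V ∧ ContDiffOn ℝ k g V ∧ g z.1 = z.2 ∧
      ∀ y ∈ V, (y, g y) ∈ W ∧ f (y, g y) = 0 := by
  have hk0 : k ≠ 0 := fun h => by simp [h] at hk
  have hat : ∀ x ∈ W, ContDiffAt ℝ k f x := fun x hx => hf.contDiffAt (hW.mem_nhds hx)
  have hinv := fderiv_comp_inr_isInvertible hd
  set g := (hat z hz).implicitFunction hk0 hinv with hg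
  have hgz : g z.1 = z.2 := (hat z hz).implicitFunction_apply_self hk0 hinv
  have hgC : ContDiffAt ℝ k g z.1 := (hat z hz).contDiffAt_implicitFunction hk0 hinv
  have hW' : {x ∈ W | fderiv ℝ f x (0, 1) ≠ 0} ∈ 𝓝 z := by
    have hc : ContinuousOn (fun x => fderiv ℝ f x (0, 1)) W :=
      (hf.continuousOn_fderiv_of_isOpen hW hk).clm_apply continuousOn_const
    exact inter_mem (hW.mem_nhds hz) ((hc.continuousAt (hW.mem_nhds hz)).eventually_ne hd)
  have hev : ∀ᶠ y in 𝓝 z.1, ContinuousAt g y ∧ (y, g y) ∈ {x ∈ W | fderiv ℝ f x (0, 1) ≠ 0} ∧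
      f (y, g y) = 0 := by
    refine Eventually.and ?_ (Eventually.and ?_ ?_)
    · filter_upwards [(hgC.of_le hk).eventually (by simp)] with y hy using hy.continuousAt
    · have : ContinuousAt (fun y => (y, g y)) z.1 := continuousAt_id.prodMk hgC.continuousAt
      exact this.preimage_mem_nhds (by simpa only [hgz] using hW')
    · simpa only [hfz] using (hat z hz).eventually_apply_implicitFunction hk0 hinv
  obtain ⟨V, hV, hVo, hzV⟩ := eventually_nhds_iff.1 hev
  refine ⟨V, g, hVo, hzV, fun y hy => ?_, hgz, fun y hy => ⟨(hV y hy).2.1.1, (hV y hy).2.2⟩⟩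
  -- For `k = ∞`, being `C^k` at one point does not give a neighbourhood where the function is
  -- `C^k`. So the theorem is applied again at each nearby point of the graph, and local uniqueness
  -- identifies the new implicit function with `g`.
  obtain ⟨hc, ⟨hyW, hyd⟩, hy0⟩ := hV y hy
  have hinv' := fderiv_comp_inr_isInvertible hyd
  have huniq := (hat _ hyW).eventually_apply_eq_iff_implicitFunction hk0 hinv'
  have hC := (hat _ hyW).contDiffAt_implicitFunction hk0 hinv'
  refine (hC.congr_of_eventuallyEq ?_).contDiffWithinAt
  have hct : ContinuousAt (fun y => (y, g y)) y := continuousAt_id.prodMk hc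
  filter_upwards [hct.eventually huniq, hVo.mem_nhds hy] with x hx hxV
  exact (hx.1 (by rw [hy0, (hV x hxV).2.2])).symm

/-- The implicit function theorem for a scalar unknown depending on a point of a manifold. -/
theorem exists_contMDiffOn_implicit [CompleteSpace Y] {H : Type*} [TopologicalSpace H]
    {I : ModelWithCorners ℝ Y H} [I.Boundaryless] {N : Type*} [TopologicalSpace N]
    [ChartedSpace H N] {k : ℕ∞ω} [IsManifold I k N] (hk : 1 ≤ k) {f : N × ℝ → ℝ}
    {W : Set (N × ℝ)} (hW : IsOpen W) (hf : ContMDiffOn (I.prod 𝓘(ℝ, ℝ)) 𝓘(ℝ, ℝ) k f W)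
    {y : N} {t : ℝ} (hz : (y, t) ∈ W) (hfz : f (y, t) = 0)
    (hd : deriv (fun s => f (y, s)) t ≠ 0) :
    ∃ (V : Set N) (g : N → ℝ), IsOpen V ∧ y ∈ V ∧ ContMDiffOn I 𝓘(ℝ, ℝ) k g V ∧ g y = t ∧
      ∀ x ∈ V, (x, g x) ∈ W ∧ f (x, g x) = 0 := by
  set e := extChartAt I y with he
  have hsymm : ContMDiffOn (𝓘(ℝ, Y).prod 𝓘(ℝ, ℝ)) (I.prod 𝓘(ℝ, ℝ)) k
      (Prod.map e.symm (id : ℝ → ℝ)) (e.target ×ˢ univ) :=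
    (contMDiffOn_extChartAt_symm y).prodMap contMDiffOn_id
  set W' : Set (Y × ℝ) := (e.target ×ˢ univ) ∩ Prod.map e.symm (id : ℝ → ℝ) ⁻¹' W with hW'
  have hW'o : IsOpen W' :=
    hsymm.continuousOn.isOpen_inter_preimage ((isOpen_extChartAt_target y).prod isOpen_univ) hW
  have hf' : ContDiffOn ℝ k (f ∘ Prod.map e.symm (id : ℝ → ℝ)) W' := by
    have h := hf.comp (hsymm.mono inter_subset_left) fun x (hx : x ∈ W') => hx.2
    rwa [← modelWithCornersSelf_prod, chartedSpaceSelf_prod, contMDiffOn_iff_contDiffOn] at h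
  have hey : e.symm (e y) = y := extChartAt_to_inv y
  have hzW' : (e y, t) ∈ W' := by
    refine ⟨⟨mem_extChartAt_target y, mem_univ _⟩, ?_⟩
    simpa [hey] using hz
  have hd' : fderiv ℝ (f ∘ Prod.map e.symm (id : ℝ → ℝ)) (e y, t) (0, 1) ≠ 0 := by
    have h1 : HasFDerivAt (f ∘ Prod.map e.symm (id : ℝ → ℝ))
        (fderiv ℝ (f ∘ Prod.map e.symm (id : ℝ → ℝ)) (e y, t)) (e y, t) :=
      ((hf'.contDiffAt (hW'o.mem_nhds hzW')).differentiableAt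
        (fun h => by simp [h] at hk)).hasFDerivAt
    have h2 : HasDerivAt (fun s : ℝ => (e y, s)) ((0 : Y), (1 : ℝ)) t :=
      (hasDerivAt_const t (e y)).prodMk (hasDerivAt_id t)
    have h3 := h1.comp_hasDerivAt t h2
    have h4 : (f ∘ Prod.map e.symm (id : ℝ → ℝ)) ∘ (fun s : ℝ => (e y, s)) = fun s => f (y, s) := by
      funext s
      simp [hey]
    rwa [← h3.deriv, h4]
  obtain ⟨V, g, hVo, hzV, hg, hgz, hV⟩ := exists_contDiffOn_implicit hk hW'o hf' hzW'
    (by simpa [hey] using hfz) hd'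
  have hchart : ContMDiffOn I 𝓘(ℝ, Y) k e e.source := by
    rw [he, extChartAt_source]; exact contMDiffOn_extChartAt
  refine ⟨e.source ∩ e ⁻¹' V, g ∘ e, hchart.continuousOn.isOpen_inter_preimage
    (isOpen_extChartAt_source y) hVo, ⟨mem_extChartAt_source y, hzV⟩,
    hg.contMDiffOn.comp (hchart.mono inter_subset_left) fun x hx => hx.2, hgz, fun x hx => ?_⟩
  have := hV _ hx.2
  have hm : Prod.map e.symm (id : ℝ → ℝ) (e x, g (e x)) = (x, g (e x)) := by
    simp [e.left_inv hx.1]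
  have h1 := this.1.2
  rw [mem_preimage, hm] at h1
  have h2 := this.2
  rw [Function.comp_apply, hm] at h2
  exact ⟨h1, h2⟩

end ImplicitFunction

end ConeGeometry

/-! ### Convex geometry of a cone and its interior -/

namespace ConeGeometry

theorem _root_.IsPreconnected.inter_frontier_nonempty {X : Type*} [TopologicalSpace X] {s t : Set X}
    (hs : IsPreconnected s) (ht : (s ∩ t).Nonempty) (htc : (s ∩ tᶜ).Nonempty) :
    (s ∩ frontier t).Nonempty := by
  by_contra hne
  rw [not_nonempty_iff_eq_empty, eq_empty_iff_forall_notMem] at hne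
  have h1 : ∀ x ∈ s, x ∈ closure t → x ∈ interior t := fun x hx hc => by
    by_contra hi
    exact hne x ⟨hx, hc, hi⟩
  obtain ⟨x, -, hxi, hxc⟩ := hs (interior t) (closure t)ᶜ isOpen_interior isClosed_closure.isOpen_compl
    (fun x hx => (em (x ∈ closure t)).imp (h1 x hx) id)
    (ht.imp fun x hx => ⟨hx.1, h1 x hx.1 (subset_closure hx.2)⟩)
    (htc.imp fun x hx => ⟨hx.1, fun hc => hx.2 (interior_subset (h1 x hx.1 hc))⟩)
  exact hxc (subset_closure (interior_subset hxi))

section ConeInterior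

variable {V : Type*} [NormedAddCommGroup V] [NormedSpace ℝ V] {C A : Set V}

theorem IsConeInterior.notMem (h : IsConeInterior C A) {v : V} (hv : v ∈ A) : v ∉ C := by
  rw [h.boundary_eq, h.isOpen.frontier_eq]
  exact fun hC => hC.1.2 hv

theorem IsConeInterior.mem_closure (h : IsConeInterior C A) {v : V} (hv : v ∈ C) :
    v ∈ closure A := by
  rw [h.boundary_eq] at hv
  exact frontier_subset_closure hv.1

theorem IsConeInterior.mem_of_frontier (h : IsConeInterior C A) {v : V} (hv : v ∈ frontier A)
    (h0 : v ≠ 0) : v ∈ C := by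
  rw [h.boundary_eq]
  exact ⟨hv, h0⟩

theorem IsConeInterior.mem_or_mem (h : IsConeInterior C A) {v : V} (hv : v ∈ closure A)
    (h0 : v ≠ 0) : v ∈ A ∨ v ∈ C := by
  by_cases hA : v ∈ A
  · exact Or.inl hA
  · exact Or.inr (h.mem_of_frontier (h.isOpen.frontier_eq ▸ ⟨hv, hA⟩) h0)

/-- If the open ray through `v` left `A`, it would meet the frontier away from `0`, hence meet `C`.
Conicity of `C` would then put `v` itself in `C`. -/
theorem IsConeInterior.smul_mem (h : IsConeInterior C A)
    (hconic : ∀ v ∈ C, ∀ c : ℝ, 0 < c → c • v ∈ C) {v : V} (hv : v ∈ A) {c : ℝ} (hc : 0 < c) :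
    c • v ∈ A := by
  by_contra hcv
  have hv0 : v ≠ 0 := fun h0 => h.zero_notMem (h0 ▸ hv)
  have hpre : IsPreconnected ((fun t : ℝ => t • v) '' Ioi 0) :=
    isPreconnected_Ioi.image _ (by fun_prop)
  obtain ⟨x, ⟨t, ht, rfl⟩, hx⟩ := hpre.inter_frontier_nonempty
    ⟨v, ⟨1, by simp, by simp⟩, hv⟩ ⟨c • v, ⟨c, hc, rfl⟩, hcv⟩
  have ht : 0 < t := ht
  have hC := hconic _ (h.mem_of_frontier hx (smul_ne_zero ht.ne' hv0)) t⁻¹ (by positivity)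
  rw [smul_smul, inv_mul_cancel₀ ht.ne', one_smul] at hC
  exact h.notMem hv hC

/-- The midpoint of a closure point and an interior point of a convex set is interior; scaling by
`2` turns it into the sum. -/
theorem IsConeInterior.add_mem (h : IsConeInterior C A)
    (hconic : ∀ v ∈ C, ∀ c : ℝ, 0 < c → c • v ∈ C) {v a : V} (hv : v ∈ closure A) (ha : a ∈ A) :
    v + a ∈ A := by
  have h1 := h.convex.combo_closure_interior_mem_interior hv (h.isOpen.interior_eq.symm ▸ ha)
    (a := 1 / 2) (b := 1 / 2) (by norm_num) (by norm_num) (by norm_num)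
  rw [h.isOpen.interior_eq] at h1
  have h2 := h.smul_mem hconic h1 (c := 2) (by norm_num)
  simpa [smul_add, smul_smul] using h2

variable {θ : V →L[ℝ] ℝ}

/-- A half line in a direction of `ker θ` starting in `A` leaves `A` through `C`. -/
theorem IsConeInterior.exists_exit (h : IsConeInterior C A)
    (hconic : ∀ v ∈ C, ∀ c : ℝ, 0 < c → c • v ∈ C) (hθ : ∀ v, v ∈ A ∨ v ∈ C → 0 < θ v)
    {a b : V} (ha : a ∈ A) (hb : b ≠ 0) (hθb : θ b = 0) : ∃ t : ℝ, 0 < t ∧ a + t • b ∈ C := by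
  by_cases hall : ∀ t : ℝ, 0 ≤ t → a + t • b ∈ A
  · exfalso
    -- A half line that never leaves `A` would, rescaled by `t⁻¹`, put its direction `b` in `closure
    -- A`. Then `b` would be causal, contradicting `θ b = 0`.
    have hlim : Tendsto (fun t : ℝ => t⁻¹ • a + b) atTop (𝓝 b) := by
      have := (tendsto_inv_atTop_zero (𝕜 := ℝ)).smul_const a |>.add_const b
      rwa [zero_smul, zero_add] at this
    have hcl : b ∈ closure A := by
      refine mem_closure_of_tendsto hlim ?_
      filter_upwards [eventually_gt_atTop (0 : ℝ)] with t ht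
      have := h.smul_mem hconic (hall t ht.le) (inv_pos.2 ht)
      rwa [smul_add, smul_smul, inv_mul_cancel₀ ht.ne', one_smul] at this
    have := hθ b (h.mem_or_mem hcl hb)
    exact this.ne' hθb
  · push Not at hall
    obtain ⟨t, ht, hnot⟩ := hall
    have hpre : IsPreconnected ((fun t : ℝ => a + t • b) '' Ici 0) :=
      isPreconnected_Ici.image _ (by fun_prop)
    obtain ⟨x, ⟨s, hs, rfl⟩, hx⟩ := hpre.inter_frontier_nonempty
      ⟨a, ⟨0, by simp, by simp⟩, ha⟩ ⟨_, ⟨t, ht, rfl⟩, hnot⟩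
    have hθs : θ (a + s • b) = θ a := by simp [hθb]
    have hne : a + s • b ≠ 0 := fun h0 => by
      rw [h0, map_zero] at hθs
      exact (hθ a (Or.inl ha)).ne hθs
    have hC := h.mem_of_frontier hx hne
    refine ⟨s, lt_of_le_of_ne hs ?_, hC⟩
    rintro rfl
    exact h.notMem ha (by simpa using hC)

/-- `A'` is connected and avoids both `C` and `0`, so it cannot cross the frontier of `A`. -/
theorem IsConeInterior.subset_of_inter_nonempty {A' : Set V} (h : IsConeInterior C A)
    (h' : IsConeInterior C A') (hne : (A' ∩ A).Nonempty) : A' ⊆ A := by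
  intro x hx
  by_contra hxA
  obtain ⟨y, hy, hyf⟩ := h'.convex.isPreconnected.inter_frontier_nonempty hne ⟨x, hx, hxA⟩
  have hy0 : y ≠ 0 := fun h0 => h'.zero_notMem (h0 ▸ hy)
  exact h'.notMem hy (h.mem_of_frontier hyf hy0)

/-- From `a ∈ A`, both directions `b` and `-b` exit through `C`, which lies in `closure A'`. As `a`
lies between the exit points, convexity puts it in `closure A'`, so `A` and `A'` meet. -/
theorem IsConeInterior.unique {A' : Set V} (h : IsConeInterior C A) (h' : IsConeInterior C A')
    (hconic : ∀ v ∈ C, ∀ c : ℝ, 0 < c → c • v ∈ C) (hθ : ∀ v, v ∈ A ∨ v ∈ C → 0 < θ v)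
    (hne : C.Nonempty) {b : V} (hb : b ≠ 0) (hθb : θ b = 0) : A' = A := by
  obtain ⟨a, ha⟩ : A.Nonempty := by
    obtain ⟨c, hc⟩ := hne
    exact closure_nonempty_iff.1 ⟨c, h.mem_closure hc⟩
  obtain ⟨t, ht, htC⟩ := h.exists_exit hconic hθ ha hb hθb
  obtain ⟨s, hs, hsC⟩ := h.exists_exit hconic hθ ha (neg_ne_zero.2 hb) (by simp [hθb])
  have hst : 0 < s + t := by positivity
  have hmem : a ∈ closure A' := by
    have := h'.convex.closure (h'.mem_closure htC) (h'.mem_closure hsC)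
      (a := s / (s + t)) (b := t / (s + t)) (by positivity) (by positivity) (by field_simp)
    have heq : (s / (s + t)) • (a + t • b) + (t / (s + t)) • (a + s • -b) = a := by
      have : (s / (s + t)) • (a + t • b) + (t / (s + t)) • (a + s • -b) =
          (s / (s + t) + t / (s + t)) • a + (s / (s + t) * t - t / (s + t) * s) • b := by module
      rw [this]
      have h1 : s / (s + t) + t / (s + t) = 1 := by field_simp
      have h2 : s / (s + t) * t - t / (s + t) * s = 0 := by ring
      rw [h1, h2, one_smul, zero_smul, add_zero]
    rwa [heq] at this
  obtain ⟨x, hxA, hxA'⟩ := mem_closure_iff.1 hmem A h.isOpen ha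
  exact (h.subset_of_inter_nonempty h' ⟨x, hxA', hxA⟩).antisymm
    (h'.subset_of_inter_nonempty h ⟨x, hxA, hxA'⟩)

/-- For a functional that is positive on all causal vectors, the cone interior is an interior. -/
theorem isConeInterior_coneInterior (hC : ∃ A, IsConeInterior C A) (hne : C.Nonempty)
    (hconic : ∀ v ∈ C, ∀ c : ℝ, 0 < c → c • v ∈ C)
    (hθ : ∀ v, v ∈ coneInterior C ∨ v ∈ C → 0 < θ v) {b : V} (hb : b ≠ 0) (hθb : θ b = 0) :
    IsConeInterior C (coneInterior C) := by
  obtain ⟨A, hA⟩ := hC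
  have hθA : ∀ v, v ∈ A ∨ v ∈ C → 0 < θ v :=
    fun v hv => hθ v (hv.imp_left fun h => ⟨A, hA, h⟩)
  have : coneInterior C = A := by
    ext v
    refine ⟨?_, fun hv => ⟨A, hA, hv⟩⟩
    rintro ⟨A', hA', hv⟩
    rwa [hA.unique hA' hconic hθA hne hb hθb] at hv
  rwa [this]

theorem IsConeInterior.exists_add_smul_mem (h : IsConeInterior C A)
    (hconic : ∀ v ∈ C, ∀ c : ℝ, 0 < c → c • v ∈ C) (hθ : ∀ v, v ∈ A ∨ v ∈ C → 0 < θ v)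
    {T w : V} (hT : T ∈ A) (hw : w ≠ 0) (hθw : θ w = 0) : ∃ t : ℝ, w + t • T ∈ C := by
  obtain ⟨t, ht, htC⟩ := h.exists_exit hconic hθ hT hw hθw
  refine ⟨t⁻¹, ?_⟩
  have := hconic _ htC t⁻¹ (inv_pos.2 ht)
  rwa [smul_add, smul_smul, inv_mul_cancel₀ ht.ne', one_smul, add_comm] at this

theorem IsConeInterior.add_smul_mem (h : IsConeInterior C A)
    (hconic : ∀ v ∈ C, ∀ c : ℝ, 0 < c → c • v ∈ C) {v T : V} (hv : v ∈ C) (hT : T ∈ A) {s : ℝ}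
    (hs : 0 < s) : v + s • T ∈ A :=
  h.add_mem hconic (h.mem_closure hv) (h.smul_mem hconic hT hs)

theorem IsConeInterior.eq_of_add_smul_mem (h : IsConeInterior C A)
    (hconic : ∀ v ∈ C, ∀ c : ℝ, 0 < c → c • v ∈ C) {T w : V} (hT : T ∈ A) {s t : ℝ}
    (hs : w + s • T ∈ C) (ht : w + t • T ∈ C) : s = t := by
  have key : ∀ s t : ℝ, w + s • T ∈ C → w + t • T ∈ C → ¬ s < t := fun s t hs ht hlt => by
    have := h.add_smul_mem hconic hs hT (sub_pos.2 hlt)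
    rw [add_assoc, ← add_smul, add_sub_cancel] at this
    exact h.notMem this ht
  exact le_antisymm (not_lt.1 (key t s ht hs)) (not_lt.1 (key s t hs ht))

theorem IsConeInterior.smul_notMem (h : IsConeInterior C A)
    (hconic : ∀ v ∈ C, ∀ c : ℝ, 0 < c → c • v ∈ C) (hθ : ∀ v, v ∈ A ∨ v ∈ C → 0 < θ v)
    {T : V} (hT : T ∈ A) (t : ℝ) : t • T ∉ C := fun hC => by
  have h1 := hθ _ (Or.inr hC)
  have h2 := hθ _ (Or.inl hT)
  rw [map_smul, smul_eq_mul] at h1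
  exact h.notMem (h.smul_mem hconic hT (pos_of_mul_pos_left h1 h2.le)) hC

end ConeInterior

/-! ### Defining functions of a cone: signs and transversality -/

section DefiningFunction

variable {V : Type*} [NormedAddCommGroup V] [NormedSpace ℝ V] {C A : Set V} {k : ℕ∞ω}
  {f : V → ℝ} {v : V}

theorem IsDefiningFunctionAt.exists_contDiffOn (hf : IsDefiningFunctionAt 𝓘(ℝ, V) k C f v) :
    (∃ U : Set V, IsOpen U ∧ v ∈ U ∧ ContDiffOn ℝ k f U ∧ ∀ y ∈ U, (y ∈ C ↔ f y = 0)) ∧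
      fderiv ℝ f v ≠ 0 := by
  obtain ⟨⟨U, hU, hvU, hfU, hUC⟩, hd⟩ := hf
  rw [mfderiv_eq_fderiv] at hd
  exact ⟨⟨U, hU, hvU, hfU.contDiffOn, hUC⟩, hd⟩

theorem IsDefiningFunctionAt.hasFDerivAt (hf : IsDefiningFunctionAt 𝓘(ℝ, V) k C f v) (hk : 1 ≤ k) :
    HasFDerivAt f (fderiv ℝ f v) v := by
  obtain ⟨⟨U, hU, hvU, hfU, hUC⟩, hd⟩ := hf.exists_contDiffOn
  exact ((hfU.contDiffAt (hU.mem_nhds hvU)).differentiableAt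
    (fun h => by simp [h] at hk)).hasFDerivAt

/-- A defining function has no zero on the interior near `v`, so its derivatives along two vectors
that point into the interior do not have opposite signs. -/
theorem IsDefiningFunctionAt.not_opposite (hf : IsDefiningFunctionAt 𝓘(ℝ, V) k C f v) (hk : 1 ≤ k)
    (h : IsConeInterior C A) {N₁ N₂ : V} (h₁ : ∀ᶠ t in 𝓝[>] (0 : ℝ), v + t • N₁ ∈ A)
    (h₂ : ∀ᶠ t in 𝓝[>] (0 : ℝ), v + t • N₂ ∈ A) (hv : v ∈ C) :
    ¬ (fderiv ℝ f v N₁ < 0 ∧ 0 < fderiv ℝ f v N₂) := by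
  rintro ⟨hn, hp⟩
  have hd := hf.hasFDerivAt hk
  obtain ⟨⟨U, hU, hvU, hfU, hUC⟩, -⟩ := hf.exists_contDiffOn
  have hfv : f v = 0 := (hUC v hvU).1 hv
  obtain ⟨ε, hε, hball⟩ := Metric.isOpen_iff.1 hU v hvU
  have hder : ∀ N : V, HasDerivAt (fun t : ℝ => f (v + t • N)) (fderiv ℝ f v N) 0 := fun N => by
    have h1 : HasDerivAt (fun t : ℝ => v + t • N) N 0 := by
      simpa using ((hasDerivAt_id (0 : ℝ)).smul_const N).const_add v
    exact HasFDerivAt.comp_hasDerivAt (x := (0 : ℝ)) (f := fun t : ℝ => v + t • N)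
      (by simpa using hd) h1
  have hsmall : ∀ N : V, ∀ᶠ t in 𝓝[>] (0 : ℝ), v + t • N ∈ Metric.ball v ε := fun N => by
    have : ContinuousAt (fun t : ℝ => v + t • N) 0 := by fun_prop
    exact mem_nhdsWithin_of_mem_nhds (this.preimage_mem_nhds (by
      simpa using Metric.ball_mem_nhds v hε))
  have hneg : ∀ᶠ t in 𝓝[>] (0 : ℝ), f (v + t • N₁) < 0 := by
    have := (hasDerivWithinAt_iff_tendsto_slope' (by simp)).1 ((hder N₁).hasDerivWithinAt (s := Ioi 0))
    filter_upwards [this.eventually (gt_mem_nhds hn), self_mem_nhdsWithin] with t ht htp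
    have htp : 0 < t := htp
    simp only [slope, sub_zero, zero_smul, add_zero, hfv, vsub_eq_sub, smul_eq_mul] at ht
    exact neg_of_mul_neg_right ht (inv_pos.2 htp).le
  have hpos : ∀ᶠ t in 𝓝[>] (0 : ℝ), 0 < f (v + t • N₂) := by
    have := (hasDerivWithinAt_iff_tendsto_slope' (by simp)).1 ((hder N₂).hasDerivWithinAt (s := Ioi 0))
    filter_upwards [this.eventually (lt_mem_nhds hp), self_mem_nhdsWithin] with t ht htp
    have htp : 0 < t := htp
    simp only [slope, sub_zero, zero_smul, add_zero, hfv, vsub_eq_sub, smul_eq_mul] at ht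
    exact pos_of_mul_pos_right ht (inv_pos.2 htp).le
  obtain ⟨t, ⟨⟨⟨⟨⟨ht1, ht2⟩, ht3⟩, ht4⟩, ht5⟩, ht6⟩⟩ :=
    (((((h₁.and h₂).and (hsmall N₁)).and (hsmall N₂)).and hneg).and hpos).exists
  -- `f` changes sign on this connected set, so it has a zero there, and that zero would be a point
  -- of both `A` and `C`.
  have hconv : Convex ℝ (A ∩ Metric.ball v ε) := h.convex.inter (convex_ball v ε)
  have hsub := hconv.isPreconnected.intermediate_value (a := v + t • N₁) (b := v + t • N₂)
    ⟨ht1, ht3⟩ ⟨ht2, ht4⟩ (hfU.continuousOn.mono fun x hx => hball hx.2)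
  obtain ⟨x, hx, hx0⟩ := hsub ⟨ht5.le, ht6.le⟩
  exact h.notMem hx.1 ((hUC x (hball hx.2)).2 hx0)

/-- If `df_v(T) = 0`, small perturbations `T + s u` and `T - s u` would still lie in the open set
`A`, hence point into `A` from `v`, while `df_v` takes opposite signs on them. -/
theorem IsDefiningFunctionAt.apply_ne_zero (hf : IsDefiningFunctionAt 𝓘(ℝ, V) k C f v)
    (hk : 1 ≤ k) (h : IsConeInterior C A) (hconic : ∀ v ∈ C, ∀ c : ℝ, 0 < c → c • v ∈ C)
    (hv : v ∈ C) {T : V} (hT : T ∈ A) : fderiv ℝ f v T ≠ 0 := by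
  intro h0
  obtain ⟨u, hu⟩ : ∃ u, 0 < fderiv ℝ f v u := by
    obtain ⟨u, hu⟩ := DFunLike.ne_iff.1 hf.exists_contDiffOn.2
    rcases lt_or_gt_of_ne hu with hu | hu
    · exact ⟨-u, by simpa using hu⟩
    · exact ⟨u, by simpa using hu⟩
  have hdir : ∀ u' : V, ∀ᶠ s in 𝓝[>] (0 : ℝ), T + s • u' ∈ A := fun u' => by
    have : ContinuousAt (fun t : ℝ => T + t • u') 0 := by fun_prop
    exact mem_nhdsWithin_of_mem_nhds (this.preimage_mem_nhds (by
      simpa using h.isOpen.mem_nhds hT))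
  obtain ⟨s, ⟨hs1, hs2⟩, hs⟩ := (((hdir u).and (hdir (-u))).and self_mem_nhdsWithin).exists
  have hs : 0 < s := hs
  have hin : ∀ N ∈ A, ∀ᶠ t in 𝓝[>] (0 : ℝ), v + t • N ∈ A := fun N hN => by
    filter_upwards [self_mem_nhdsWithin] with t ht using h.add_smul_mem hconic hv hN ht
  refine hf.not_opposite hk h (hin _ hs2) (hin _ hs1) hv ⟨?_, ?_⟩
  · simp only [map_add, h0, map_smul, map_neg, smul_eq_mul]
    nlinarith
  · simp only [map_add, h0, map_smul, smul_eq_mul]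
    nlinarith

/-- This allows the transverse vector `N` of the convexity condition to be exchanged for `T` without
changing the sign of the second fundamental form. -/
theorem IsDefiningFunctionAt.div_pos (hf : IsDefiningFunctionAt 𝓘(ℝ, V) k C f v) (hk : 1 ≤ k)
    (h : IsConeInterior C A) (hconic : ∀ v ∈ C, ∀ c : ℝ, 0 < c → c • v ∈ C) (hv : v ∈ C) {T N : V}
    (hT : T ∈ A) (hN : ∀ᶠ t in 𝓝[>] (0 : ℝ), v + t • N ∈ A) (hN0 : fderiv ℝ f v N ≠ 0) :
    0 < fderiv ℝ f v N / fderiv ℝ f v T := by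
  have hT0 := hf.apply_ne_zero hk h hconic hv hT
  have hTin : ∀ᶠ t in 𝓝[>] (0 : ℝ), v + t • T ∈ A := by
    filter_upwards [self_mem_nhdsWithin] with t ht using h.add_smul_mem hconic hv hT ht
  have h1 := hf.not_opposite hk h hTin hN hv
  have h2 := hf.not_opposite hk h hN hTin hv
  rcases lt_or_gt_of_ne hT0 with hT1 | hT1 <;> rcases lt_or_gt_of_ne hN0 with hN1 | hN1
  · exact div_pos_of_neg_of_neg hN1 hT1
  · exact absurd ⟨hT1, hN1⟩ h1
  · exact absurd ⟨hN1, hT1⟩ h2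
  · exact _root_.div_pos hN1 hT1

end DefiningFunction

end ConeGeometry

/-! ### From the second fundamental form to the fundamental tensor -/

namespace ConeGeometry

theorem ContDiffAt.differentiableAt_deriv {g : ℝ → ℝ} {s : ℝ} (hg : ContDiffAt ℝ 2 g s) :
    DifferentiableAt ℝ (deriv g) s := by
  have h : ContDiffAt ℝ 1 (fderiv ℝ g) s := hg.fderiv_right (by norm_num)
  have h' : DifferentiableAt ℝ (fun x => fderiv ℝ g x 1) s :=
    (h.differentiableAt (by norm_num)).clm_apply (differentiableAt_const _)
  simpa only [fderiv_apply_one_eq_deriv] using h'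

/-- On the diagonal the tensor sees only the line `w + s u`, where it is half the second derivative
of `g ^ 2`. No topology on `W` is needed. -/
theorem fundamentalTensor_sq {W : Type*} [AddCommGroup W] [Module ℝ W] {F : W → ℝ} {w u : W}
    {g : ℝ → ℝ} (hg : ContDiffAt ℝ 2 g 0) (h : ∀ᶠ s in 𝓝 (0 : ℝ), F (w + s • u) = g s) :
    fundamentalTensor (fun x => F x ^ 2) w u u = deriv g 0 ^ 2 + g 0 * deriv (deriv g) 0 := by
  have hinner : (fun r : ℝ => deriv (fun s : ℝ => F (w + r • u + s • u) ^ 2) 0) =ᶠ[𝓝 0]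
      fun r => 2 * g r * deriv g r := by
    filter_upwards [h.eventually_nhds, hg.eventually (by simp)] with r hr hgr
    have h1 : (fun s : ℝ => F (w + r • u + s • u) ^ 2) =ᶠ[𝓝 0] fun s => g (r + s) ^ 2 := by
      have hc : Tendsto (fun s : ℝ => r + s) (𝓝 0) (𝓝 r) := by
        have : ContinuousAt (fun s : ℝ => r + s) 0 := by fun_prop
        simpa [ContinuousAt] using this
      filter_upwards [hc.eventually hr] with s hs
      rw [← hs, add_smul, add_assoc]
    rw [h1.deriv_eq]
    have hd : HasDerivAt (fun s => g (r + s)) (deriv g r) 0 := by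
      have := (hgr.differentiableAt (by norm_num)).hasDerivAt
      exact HasDerivAt.comp_const_add r 0 (by simpa using this)
    simpa using (hd.fun_pow 2).deriv
  rw [fundamentalTensor, hinner.deriv_eq]
  have h1 := (hg.differentiableAt (by norm_num)).hasDerivAt
  have h2 := (ContDiffAt.differentiableAt_deriv hg).hasDerivAt
  rw [((h1.const_mul 2).fun_mul h2).deriv]
  ring

/-- A vector on which a positive semi-definite form vanishes lies in its radical. -/
theorem eq_zero_of_psd {V : Type*} [AddCommGroup V] [Module ℝ V] {B : V → V → ℝ} {S : Submodule ℝ V}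
    (hadd : ∀ x y z, B (x + y) z = B x z + B y z) (hsmul : ∀ (c : ℝ) x y, B (c • x) y = c * B x y)
    (hsymm : ∀ x y, B x y = B y x) (hpsd : ∀ x ∈ S, 0 ≤ B x x) {x y : V} (hx : x ∈ S) (hy : y ∈ S)
    (h0 : B x x = 0) : B x y = 0 := by
  -- This is `B` at `x + t y`; with zero constant term, the discriminant is `4 (B x y)²`.
  have key : ∀ t : ℝ, 0 ≤ B y y * (t * t) + 2 * B x y * t + 0 := fun t => by
    have := hpsd (x + t • y) (S.add_mem hx (S.smul_mem t hy))
    rw [hadd, hsmul, hsymm x, hsymm y, hadd, hadd, hsmul, hsmul, h0, hsymm y x] at this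
    linarith
  have := discrim_le_zero key
  rw [discrim] at this
  nlinarith [sq_nonneg (B x y)]

section SecondDerivative

variable {V : Type*} [NormedAddCommGroup V] [NormedSpace ℝ V] {f : V → ℝ}

/-- The second derivative of `f ∘ γ = 0`. -/
theorem fderiv_fderiv_add_eq_zero {w u T : V} {g : ℝ → ℝ} (hg : ContDiffAt ℝ 2 g 0)
    (hf : ContDiffAt ℝ 2 f (w + g 0 • T))
    (h : ∀ᶠ s in 𝓝 (0 : ℝ), f (w + s • u + g s • T) = 0) :
    fderiv ℝ f (w + g 0 • T) (u + deriv g 0 • T) = 0 ∧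
    fderiv ℝ (fderiv ℝ f) (w + g 0 • T) (u + deriv g 0 • T) (u + deriv g 0 • T) +
      deriv (deriv g) 0 * fderiv ℝ f (w + g 0 • T) T = 0 := by
  set γ : ℝ → V := fun s => w + s • u + g s • T with hγ
  have hγ0 : γ 0 = w + g 0 • T := by simp [hγ]
  rw [← hγ0] at hf ⊢
  have hdγ : ∀ s, DifferentiableAt ℝ g s → HasDerivAt γ (u + deriv g s • T) s := fun s hs => by
    have h1 : HasDerivAt (fun s : ℝ => w + s • u) u s := by
      simpa using ((hasDerivAt_id s).smul_const u).const_add w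
    exact h1.add (hs.hasDerivAt.smul_const T)
  have hgd := (hg.differentiableAt (by norm_num))
  have hcont : ContinuousAt γ 0 := (hdγ 0 hgd).continuousAt
  have hfirst : (fun s => fderiv ℝ f (γ s) (u + deriv g s • T)) =ᶠ[𝓝 0] fun _ => 0 := by
    filter_upwards [h.eventually_nhds, hg.eventually (by simp),
      hcont.eventually (hf.eventually (by simp))] with s hs hgs hfs
    have h1 := (hfs.differentiableAt (by norm_num)).hasFDerivAt.comp_hasDerivAt s
      (hdγ s (hgs.differentiableAt (by norm_num)))
    have h2 : f ∘ γ =ᶠ[𝓝 s] fun _ => 0 := hs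
    rw [← h1.deriv, h2.deriv_eq, deriv_const]
  refine ⟨hfirst.self_of_nhds, ?_⟩
  have hf' : DifferentiableAt ℝ (fderiv ℝ f) (γ 0) :=
    (hf.fderiv_right (m := 1) (by norm_num)).differentiableAt (by norm_num)
  have h1 : HasDerivAt (fun s => fderiv ℝ f (γ s))
      (fderiv ℝ (fderiv ℝ f) (γ 0) (u + deriv g 0 • T)) 0 :=
    hf'.hasFDerivAt.comp_hasDerivAt 0 (hdγ 0 hgd)
  have h2 : HasDerivAt (fun s => u + deriv g s • T) (deriv (deriv g) 0 • T) 0 :=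
    ((ContDiffAt.differentiableAt_deriv hg).hasDerivAt.smul_const T).const_add u
  have h3 := (h1.clm_apply h2).deriv
  rw [hfirst.deriv_eq, deriv_const] at h3
  simpa using h3.symm

end SecondDerivative

section PosDef

variable {V : Type*} [NormedAddCommGroup V] [NormedSpace ℝ V] {C A : Set V} {k : ℕ∞ω}
  {θ : V →L[ℝ] ℝ}

/-- Strong convexity of the cone makes the fundamental tensor positive definite. -/
theorem fundamentalTensor_pos_of_isStronglyConvexAt (hk : 2 ≤ k) (h : IsConeInterior C A)
    (hconic : ∀ v ∈ C, ∀ c : ℝ, 0 < c → c • v ∈ C) {T : V} (hT : T ∈ A) (hθT : θ T = 1)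
    {F : LinearMap.ker θ.toLinearMap → ℝ}
    (hF : ∀ (x : LinearMap.ker θ.toLinearMap) (t : ℝ), (x : V) + t • T ∈ C → t = F x)
    {w : LinearMap.ker θ.toLinearMap} (hw : (w : V) + F w • T ∈ C) (hFw : 0 < F w)
    (hconv : IsStronglyConvexAt k C A ((w : V) + F w • T))
    {u : LinearMap.ker θ.toLinearMap} (hu : u ≠ 0) :
    0 < fundamentalTensor (fun x => F x ^ 2) w u u := by
  have hk1 : 1 ≤ k := le_trans (by norm_num) hk
  obtain ⟨f, N, hf, hN0, hN, hpsd, hrad⟩ := hconv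
  obtain ⟨⟨U, hU, hvU, hfU, hUC⟩, -⟩ := hf.exists_contDiffOn
  have hT0 := hf.apply_ne_zero hk1 h hconic hw hT
  have hdiv := hf.div_pos hk1 h hconic hw hT hN hN0
  -- Only the plane through `w` spanned by `u` and `T` matters. Solving `f ∘ j = 0` for the second
  -- coordinate gives the values of `F` on the line `w + s u`.
  set j : ℝ × ℝ → V := fun z => (w : V) + z.1 • (u : V) + z.2 • T with hj
  have hjC : ContDiff ℝ k j := by fun_prop
  have hj0 : j (0, F w) = (w : V) + F w • T := by simp [hj]
  obtain ⟨O, g, hO, h0O, hgO, hg0, hgC⟩ : ∃ (O : Set ℝ) (g : ℝ → ℝ), IsOpen O ∧ (0 : ℝ) ∈ O ∧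
      ContDiffOn ℝ k g O ∧ g 0 = F w ∧ ∀ s ∈ O, (s, g s) ∈ j ⁻¹' U ∧ (f ∘ j) (s, g s) = 0 := by
    refine exists_contDiffOn_implicit (z := (0, F w)) hk1 (hU.preimage hjC.continuous)
      (hfU.comp hjC.contDiffOn (fun x hx => hx)) (by simpa [hj0] using hvU) ?_ ?_
    · rw [Function.comp_apply, hj0]
      exact (hUC _ hvU).1 hw
    · have h1 : HasFDerivAt f (fderiv ℝ f ((w : V) + F w • T)) (j (0, F w)) := by
        rw [hj0]
        exact hf.hasFDerivAt hk1
      have h2 : HasFDerivAt j (fderiv ℝ j (0, F w)) (0, F w) :=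
        (hjC.differentiable (fun h => by simp [h] at hk1) _).hasFDerivAt
      have h3 : fderiv ℝ j (0, F w) (0, 1) = T := by
        have h4 : HasDerivAt (fun t : ℝ => ((0 : ℝ), t)) ((0 : ℝ), (1 : ℝ)) (F w) :=
          (hasDerivAt_const _ _).prodMk (hasDerivAt_id _)
        have h5 : HasDerivAt (fun t : ℝ => (w : V) + (0 : ℝ) • (u : V) + t • T) T (F w) := by
          simpa using ((hasDerivAt_id (F w)).smul_const T).const_add
            ((w : V) + (0 : ℝ) • (u : V))
        exact (h2.comp_hasDerivAt (F w) h4).unique h5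
      rw [(h1.comp _ h2).fderiv, ContinuousLinearMap.comp_apply, h3]
      exact hT0
  have hg : ContDiffAt ℝ 2 g 0 := (hgO.contDiffAt (hO.mem_nhds h0O)).of_le hk
  have hfv : ContDiffAt ℝ 2 f ((w : V) + F w • T) := (hfU.contDiffAt (hU.mem_nhds hvU)).of_le hk
  have hFg : ∀ᶠ s in 𝓝 (0 : ℝ), F (w + s • u) = g s := by
    filter_upwards [hO.mem_nhds h0O] with s hs
    exact (hF (w + s • u) (g s) ((hUC _ (hgC s hs).1).2 (hgC s hs).2)).symm
  rw [fundamentalTensor_sq hg hFg, hg0]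
  have hf0 : ∀ᶠ s in 𝓝 (0 : ℝ), f ((w : V) + s • (u : V) + g s • T) = 0 := by
    filter_upwards [hO.mem_nhds h0O] with s hs using (hgC s hs).2
  obtain ⟨hd1, hd2⟩ := fderiv_fderiv_add_eq_zero hg (hg0 ▸ hfv) hf0
  rw [hg0] at hd1 hd2
  set y : V := (u : V) + deriv g 0 • T with hy
  set v : V := (w : V) + F w • T with hv
  have hII : deriv (deriv g) 0 =
      secondFundamentalForm f v N y y * (fderiv ℝ f v N / fderiv ℝ f v T) := by
    rw [secondFundamentalForm]
    field_simp
    linarith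
  have hnn : 0 ≤ deriv (deriv g) 0 := hII ▸ mul_nonneg (hpsd y hd1) hdiv.le
  refine lt_of_le_of_ne (add_nonneg (sq_nonneg _) (mul_nonneg hFw.le hnn)) fun heq => hu ?_
  have hg1 : deriv g 0 = 0 := by nlinarith [mul_nonneg hFw.le hnn, sq_nonneg (deriv g 0)]
  have hg2 : deriv (deriv g) 0 = 0 := by
    rw [hg1] at heq
    have : F w * deriv (deriv g) 0 = 0 := by linarith
    exact (mul_eq_zero.1 this).resolve_left hFw.ne'
  have hIIy : secondFundamentalForm f v N y y = 0 := by
    rw [hg2] at hII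
    exact (mul_eq_zero.1 hII.symm).resolve_right hdiv.ne'
  have hsymm : ∀ a b, fderiv ℝ (fderiv ℝ f) v a b = fderiv ℝ (fderiv ℝ f) v b a := fun a b =>
    (hfv.isSymmSndFDerivAt (by simp)).eq a b
  have hadd : ∀ a b c, secondFundamentalForm f v N (a + b) c =
      secondFundamentalForm f v N a c + secondFundamentalForm f v N b c := fun a b c => by
    simp only [secondFundamentalForm, map_add, add_apply]
    ring
  have hsmul : ∀ (c : ℝ) a b, secondFundamentalForm f v N (c • a) b =
      c * secondFundamentalForm f v N a b := fun c a b => by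
    simp only [secondFundamentalForm, map_smul, smul_apply, smul_eq_mul]
    ring
  -- A null vector of a semi-definite form lies in its radical, so `y = c v`. Applying `θ` gives `c
  -- F(w) = 0`, hence `c = 0` and `u = 0`.
  obtain ⟨c, hc⟩ := (hrad y hd1).1 fun x hx =>
    eq_zero_of_psd (B := secondFundamentalForm f v N) (S := LinearMap.ker (fderiv ℝ f v).toLinearMap)
      hadd hsmul (fun a b => by simp only [secondFundamentalForm, hsymm a b])
      (fun a ha => hpsd a ha) hd1 hx hIIy
  have hu0 : θ (u : V) = 0 := u.2
  have hw0 : θ (w : V) = 0 := w.2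
  have hc' := congrArg θ hc
  simp only [hy, hv, hg1, map_add, map_smul, hu0, hw0, hθT, smul_eq_mul, zero_smul, add_zero,
    zero_add, mul_one] at hc'
  have hc0 : c = 0 := (mul_eq_zero.1 hc'.symm).resolve_right hFw.ne'
  rw [hc0, zero_smul, hy, hg1, zero_smul, add_zero] at hc
  exact Subtype.ext hc

end PosDef

end ConeGeometry

/-! ### Smooth maps of the tangent bundle -/

namespace ConeGeometry

section TangentBundle

variable {E : Type*} [NormedAddCommGroup E] [NormedSpace ℝ E]
  {M : Type*} [TopologicalSpace M] [ChartedSpace E M] [IsManifold 𝓘(ℝ, E) 1 M] {k : ℕ∞ω}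

theorem contMDiff_fiberInclusion [ContMDiffVectorBundle k E (TangentSpace 𝓘(ℝ, E) : M → Type _) 𝓘(ℝ, E)]
    (p : M) :
    ContMDiff 𝓘(ℝ, E) 𝓘(ℝ, E).tangent k (fun u : E => (⟨p, u⟩ : TangentBundle 𝓘(ℝ, E) M)) := by
  intro u
  rw [contMDiffAt_totalSpace]
  refine ⟨contMDiffAt_const, ?_⟩
  let L : E →L[ℝ] E :=
    (trivializationAt E (TangentSpace 𝓘(ℝ, E) : M → Type _) p).continuousLinearMapAt ℝ p
  have hL : ∀ x : TangentSpace 𝓘(ℝ, E) p, (trivializationAt E (TangentSpace 𝓘(ℝ, E)) p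
      (⟨p, x⟩ : TangentBundle 𝓘(ℝ, E) M)).2 =
      (trivializationAt E (TangentSpace 𝓘(ℝ, E)) p).continuousLinearMapAt ℝ p x := fun x => by
    rw [Trivialization.continuousLinearMapAt_apply, Trivialization.linearMapAt_apply,
      if_pos (mem_baseSet_trivializationAt E _ p)]
  exact (L.contDiff.contMDiff u).congr_of_eventuallyEq (Eventually.of_forall hL)

variable {E' : Type*} [NormedAddCommGroup E'] [NormedSpace ℝ E'] {H' : Type*} [TopologicalSpace H']
  {J : ModelWithCorners ℝ E' H'} {N : Type*} [TopologicalSpace N] [ChartedSpace H' N]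

theorem contMDiffAt_add_smul
    {b : N → M} {v₁ v₂ : ∀ n, TangentSpace 𝓘(ℝ, E) (b n)} {c : N → ℝ} {n : N}
    (h₁ : ContMDiffAt J 𝓘(ℝ, E).tangent k (fun n => (⟨b n, v₁ n⟩ : TangentBundle 𝓘(ℝ, E) M)) n)
    (h₂ : ContMDiffAt J 𝓘(ℝ, E).tangent k (fun n => (⟨b n, v₂ n⟩ : TangentBundle 𝓘(ℝ, E) M)) n)
    (hc : ContMDiffAt J 𝓘(ℝ, ℝ) k c n) :
    ContMDiffAt J 𝓘(ℝ, E).tangent k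
      (fun n => (⟨b n, v₁ n + c n • v₂ n⟩ : TangentBundle 𝓘(ℝ, E) M)) n := by
  rw [contMDiffAt_totalSpace] at h₁ h₂ ⊢
  refine ⟨h₁.1, (h₁.2.add (hc.smul h₂.2)).congr_of_eventuallyEq ?_⟩
  have hev : ∀ᶠ m in 𝓝 n, b m ∈ (trivializationAt E (TangentSpace 𝓘(ℝ, E)) (b n)).baseSet :=
    h₁.1.continuousAt.preimage_mem_nhds ((trivializationAt E _ (b n)).open_baseSet.mem_nhds
      (mem_baseSet_trivializationAt E _ (b n)))
  filter_upwards [hev] with m hm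
  have hlin := Trivialization.linear ℝ (trivializationAt E (TangentSpace 𝓘(ℝ, E)) (b n)) hm
  simp only [Pi.add_apply, Pi.smul_apply']
  rw [hlin.map_add, hlin.map_smul]

theorem IsContDiffOneForm.contMDiff_apply {Ω : ∀ p : M, TangentSpace 𝓘(ℝ, E) p →L[ℝ] ℝ}
    [ContMDiffVectorBundle k E (TangentSpace 𝓘(ℝ, E) : M → Type _) 𝓘(ℝ, E)]
    (hΩ : IsContDiffOneForm k Ω) : ContMDiff 𝓘(ℝ, E).tangent 𝓘(ℝ, ℝ) k
      (fun x : TangentBundle 𝓘(ℝ, E) M => Ω x.proj x.snd) := by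
  have hproj : ContMDiff 𝓘(ℝ, E).tangent 𝓘(ℝ, E) k
      (fun x : TangentBundle 𝓘(ℝ, E) M => x.proj) := contMDiff_proj _
  have h := ContMDiff.clm_bundle_apply (E₂ := Bundle.Trivial M ℝ) (hΩ.comp hproj)
    (v := fun x => x.snd) contMDiff_id
  intro x
  have h1 := (contMDiffAt_totalSpace.1 (h x)).2
  exact h1

theorem contMDiff_kerProj {Ω : ∀ p : M, TangentSpace 𝓘(ℝ, E) p →L[ℝ] ℝ}
    {T : ∀ p : M, TangentSpace 𝓘(ℝ, E) p}
    [ContMDiffVectorBundle k E (TangentSpace 𝓘(ℝ, E) : M → Type _) 𝓘(ℝ, E)]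
    (hΩ : IsContDiffOneForm k Ω) (hTC : IsContDiffVectorField k T) (hT : ∀ p : M, Ω p (T p) = 1) :
    ContMDiff 𝓘(ℝ, E).tangent 𝓘(ℝ, E).tangent k (fun x : TangentBundle 𝓘(ℝ, E) M =>
      (⟨x.proj, kerProj Ω T hT x.proj x.snd⟩ : TangentBundle 𝓘(ℝ, E) M)) := by
  intro x
  have hproj : ContMDiff 𝓘(ℝ, E).tangent 𝓘(ℝ, E) k
      (fun x : TangentBundle 𝓘(ℝ, E) M => x.proj) := contMDiff_proj _
  have h := contMDiffAt_add_smul (b := fun x : TangentBundle 𝓘(ℝ, E) M => x.proj)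
    (v₁ := fun x => x.snd) (v₂ := fun x => T x.proj) (c := fun x => -Ω x.proj x.snd)
    (contMDiffAt_id (x := x)) (hTC.comp hproj x) (hΩ.contMDiff_apply x).neg
  refine h.congr_of_eventuallyEq (Eventually.of_forall fun y => ?_)
  simp only [kerProj, neg_smul, sub_eq_add_neg]

theorem contMDiff_add_smul_field {T : ∀ p : M, TangentSpace 𝓘(ℝ, E) p}
    [ContMDiffVectorBundle k E (TangentSpace 𝓘(ℝ, E) : M → Type _) 𝓘(ℝ, E)]
    (hTC : IsContDiffVectorField k T) :
    ContMDiff (𝓘(ℝ, E).tangent.prod 𝓘(ℝ, ℝ)) 𝓘(ℝ, E).tangent k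
      (fun x : TangentBundle 𝓘(ℝ, E) M × ℝ =>
        (⟨x.1.proj, x.1.snd + x.2 • T x.1.proj⟩ : TangentBundle 𝓘(ℝ, E) M)) := by
  have hproj : ContMDiff 𝓘(ℝ, E).tangent 𝓘(ℝ, E) k
      (fun x : TangentBundle 𝓘(ℝ, E) M => x.proj) := contMDiff_proj _
  exact fun x => contMDiffAt_add_smul (b := fun x : TangentBundle 𝓘(ℝ, E) M × ℝ => x.1.proj)
    (v₁ := fun x => x.1.snd) (v₂ := fun x => T x.1.proj) (c := fun x => x.2)
    (contMDiffAt_fst (p := x)) ((hTC.comp (hproj.comp contMDiff_fst)) x) contMDiffAt_snd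

theorem fderiv_fiber_eq_comp [ContMDiffVectorBundle 1 E (TangentSpace 𝓘(ℝ, E) : M → Type _) 𝓘(ℝ, E)]
    {f : TangentBundle 𝓘(ℝ, E) M → ℝ} {p : M} {w : E}
    (hf : MDifferentiableAt 𝓘(ℝ, E).tangent 𝓘(ℝ, ℝ) f ⟨p, w⟩) (u : E) :
    fderiv ℝ (fun x : E => f ⟨p, x⟩) w u = mfderiv 𝓘(ℝ, E).tangent 𝓘(ℝ, ℝ) f ⟨p, w⟩
      (mfderiv 𝓘(ℝ, E) 𝓘(ℝ, E).tangent
        (fun x : E => (⟨p, x⟩ : TangentBundle 𝓘(ℝ, E) M)) w u) := by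
  have h1 := ((contMDiff_fiberInclusion (k := 1) p).mdifferentiableAt (by norm_num) (x := w))
  have h2 := (hf.hasMFDerivAt).comp w h1.hasMFDerivAt
  have h3 := h2.mfderiv
  rw [← mfderiv_eq_fderiv]
  exact congrArg (fun L => L u) h3

end TangentBundle

end ConeGeometry

/-! ### Transversality to the fibres and smooth dependence of solutions -/

namespace ConeGeometry

theorem exists_ne_zero_apply_eq_zero {V : Type*} [NormedAddCommGroup V] [NormedSpace ℝ V]
    (hdim : 2 ≤ Module.finrank ℝ V) (θ : V →L[ℝ] ℝ) : ∃ b : V, b ≠ 0 ∧ θ b = 0 := by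
  have : FiniteDimensional ℝ V := Module.finite_of_finrank_pos (by omega)
  have hker : LinearMap.ker θ.toLinearMap ≠ ⊥ :=
    LinearMap.ker_ne_bot_of_finrank_lt (by rw [Module.finrank_self]; omega)
  obtain ⟨b, hb, hb0⟩ := Submodule.exists_mem_ne_zero_of_ne_bot hker
  exact ⟨b, hb0, hb⟩

theorem _root_.Submodule.sup_ker_eq_top_of_apply_ne_zero {K V : Type*} [Field K] [AddCommGroup V]
    [Module K V] {S : Submodule K V} {D : V →ₗ[K] K} {z : V} (hz : z ∈ S) (hDz : D z ≠ 0) :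
    S ⊔ LinearMap.ker D = ⊤ := by
  rw [eq_top_iff]
  intro y _
  have hy : y - (D y / D z) • z ∈ LinearMap.ker D := by
    rw [LinearMap.mem_ker, map_sub, map_smul, smul_eq_mul, div_mul_cancel₀ _ hDz, sub_self]
  have := Submodule.add_mem_sup (S.smul_mem (D y / D z) hz) hy
  rwa [add_sub_cancel] at this

section Manifold

variable {E : Type*} [NormedAddCommGroup E] [NormedSpace ℝ E]
  {M : Type*} [TopologicalSpace M] [ChartedSpace E M] [IsManifold 𝓘(ℝ, E) 1 M] {k : ℕ∞ω}
  {C : Set (TangentBundle 𝓘(ℝ, E) M)}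

theorem IsDefiningFunctionAt.coneFiber
    [ContMDiffVectorBundle k E (TangentSpace 𝓘(ℝ, E) : M → Type _) 𝓘(ℝ, E)]
    {f : TangentBundle 𝓘(ℝ, E) M → ℝ} {p : M} {v : E}
    (hf : IsDefiningFunctionAt 𝓘(ℝ, E).tangent k C f ⟨p, v⟩)
    (hd : fderiv ℝ (fun x : E => f ⟨p, x⟩) v ≠ 0) :
    IsDefiningFunctionAt 𝓘(ℝ, E) k (coneFiber C p) (fun x : E => f ⟨p, x⟩) v := by
  obtain ⟨⟨U, hU, hvU, hfU, hUC⟩, -⟩ := hf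
  have hincl := contMDiff_fiberInclusion (E := E) (k := k) p
  refine ⟨⟨_, hU.preimage hincl.continuous, hvU,
    hfU.comp hincl.contMDiffOn fun x hx => hx, fun y hy => hUC _ hy⟩, ?_⟩
  rwa [mfderiv_eq_fderiv]

theorem IsDefiningFunctionAt.mdifferentiableAt {f : TangentBundle 𝓘(ℝ, E) M → ℝ}
    {x : TangentBundle 𝓘(ℝ, E) M} (hk : 1 ≤ k)
    (hf : IsDefiningFunctionAt 𝓘(ℝ, E).tangent k C f x) :
    MDifferentiableAt 𝓘(ℝ, E).tangent 𝓘(ℝ, ℝ) f x := by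
  obtain ⟨⟨U, hU, hxU, hfU, -⟩, -⟩ := hf
  exact (hfU.contMDiffAt (hU.mem_nhds hxU)).mdifferentiableAt (fun h => by simp [h] at hk)

/-- Transversality to the fibre of a hypersurface of `TM` through the derivative of a defining
function along the fibre. -/
theorem transverse_iff_fderiv_fiber_ne_zero
    [ContMDiffVectorBundle 1 E (TangentSpace 𝓘(ℝ, E) : M → Type _) 𝓘(ℝ, E)]
    {f : TangentBundle 𝓘(ℝ, E) M → ℝ} {p : M} {w : E}
    (hf : MDifferentiableAt 𝓘(ℝ, E).tangent 𝓘(ℝ, ℝ) f ⟨p, w⟩)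
    (hd : mfderiv 𝓘(ℝ, E).tangent 𝓘(ℝ, ℝ) f ⟨p, w⟩ ≠ 0) :
    fiberTangentSpace p w ⊔
      LinearMap.ker (mfderiv 𝓘(ℝ, E).tangent 𝓘(ℝ, ℝ) f ⟨p, w⟩).toLinearMap = ⊤ ↔
    fderiv ℝ (fun x : E => f ⟨p, x⟩) w ≠ 0 := by
  constructor
  · intro htop h0
    refine hd ?_
    have hle : fiberTangentSpace p w ≤
        LinearMap.ker (mfderiv 𝓘(ℝ, E).tangent 𝓘(ℝ, ℝ) f ⟨p, w⟩).toLinearMap := by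
      rintro _ ⟨u, rfl⟩
      have := fderiv_fiber_eq_comp hf u
      rw [h0] at this
      exact this.symm
    rw [sup_eq_right.2 hle] at htop
    ext u
    have hu : u ∈ (⊤ : Submodule ℝ (TangentSpace 𝓘(ℝ, E).tangent
      (⟨p, w⟩ : TangentBundle 𝓘(ℝ, E) M))) := Submodule.mem_top
    rw [← htop] at hu
    exact hu
  · intro h0
    obtain ⟨u, hu⟩ := DFunLike.ne_iff.1 h0
    rw [fderiv_fiber_eq_comp hf u] at hu
    exact Submodule.sup_ker_eq_top_of_apply_ne_zero (D := (mfderiv 𝓘(ℝ, E).tangent 𝓘(ℝ, ℝ) f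
      (⟨p, w⟩ : TangentBundle 𝓘(ℝ, E) M)).toLinearMap) ⟨u, rfl⟩ hu

/-- The solution of `w + t T ∈ C` is of class `C^k`. -/
theorem IsConeStructure.exists_contMDiffOn [FiniteDimensional ℝ E]
    [ContMDiffVectorBundle k E (TangentSpace 𝓘(ℝ, E) : M → Type _) 𝓘(ℝ, E)]
    [IsManifold 𝓘(ℝ, E) k M] (hk : 1 ≤ k) (hC : IsConeStructure k C)
    {T : ∀ p : M, TangentSpace 𝓘(ℝ, E) p} (hTC : IsContDiffVectorField k T) {p : M} {w : TangentSpace 𝓘(ℝ, E) p}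
    {t : ℝ} {A : Set E} (hA : IsConeInterior (coneFiber C p) A) (hTA : T p ∈ A)
    (hwt : w + t • T p ∈ coneFiber C p) :
    ∃ (U : Set (TangentBundle 𝓘(ℝ, E) M)) (G : TangentBundle 𝓘(ℝ, E) M → ℝ),
      IsOpen U ∧ (⟨p, w⟩ : TangentBundle 𝓘(ℝ, E) M) ∈ U ∧
      ContMDiffOn 𝓘(ℝ, E).tangent 𝓘(ℝ, ℝ) k G U ∧
      ∀ x ∈ U, (⟨x.proj, x.snd + G x • T x.proj⟩ : TangentBundle 𝓘(ℝ, E) M) ∈ C := by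
  have : ContMDiffVectorBundle 1 E (TangentSpace 𝓘(ℝ, E) : M → Type _) 𝓘(ℝ, E) :=
    ContMDiffVectorBundle.of_le hk
  have : CompleteSpace E := FiniteDimensional.complete ℝ E
  obtain ⟨f, hf, htr⟩ := hC.transverse p _ hwt
  -- Transversality makes the restriction of `f` to the fibre a defining function of `C_p`, so its
  -- derivative along `T_p` is nonzero. The equation is solved on an open set of `TM`, so `G` is the
  -- local extension required of a Finsler metric.
  have hd := (transverse_iff_fderiv_fiber_ne_zero (hf.mdifferentiableAt hk) hf.2).1 htr
  have hfib := hf.coneFiber hd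
  have hT0 := hfib.apply_ne_zero hk hA (hC.strongCone p).conic hwt hTA
  obtain ⟨⟨O, hO, hvO, hfO, hOC⟩, -⟩ := hf
  have hm := contMDiff_add_smul_field hTC
  obtain ⟨U, G, hU, hwU, hG, -, hUG⟩ := exists_contMDiffOn_implicit (I := 𝓘(ℝ, E).tangent)
    (y := (⟨p, w⟩ : TangentBundle 𝓘(ℝ, E) M)) (t := t) hk
    (hO.preimage hm.continuous) (hfO.comp hm.contMDiffOn fun x hx => hx) hvO
    ((hOC _ hvO).1 hwt) (by
      let τ : E := T p
      let w' : E := w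
      have h1 : HasDerivAt (fun s : ℝ => w' + s • τ) τ t := by
        simpa using ((hasDerivAt_id t).smul_const τ).const_add w'
      have h2 := HasFDerivAt.comp_hasDerivAt t (hfib.hasFDerivAt hk) h1
      exact h2.deriv.trans_ne hT0)
  exact ⟨U, G, hU, hwU, hG, fun x hx => (hOC _ (hUG x hx).1).2 (hUG x hx).2⟩

end Manifold

end ConeGeometry

/-! ### From cone structures to Finsler metrics -/

namespace ConeGeometry

section Manifold

variable {E : Type*} [NormedAddCommGroup E] [NormedSpace ℝ E]
  {M : Type*} [TopologicalSpace M] [ChartedSpace E M]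
  {C : Set (TangentBundle 𝓘(ℝ, E) M)} {Ω : ∀ p : M, TangentSpace 𝓘(ℝ, E) p →L[ℝ] ℝ}
  {T : ∀ p : M, TangentSpace 𝓘(ℝ, E) p}

theorem kerProj_add_smul (hT : ∀ p : M, Ω p (T p) = 1) (p : M) (w : kerFiber Ω p) (t : ℝ) :
    kerProj Ω T hT p ((w : TangentSpace 𝓘(ℝ, E) p) + t • T p) = w := by
  have hw : Ω p w = 0 := w.2
  apply Subtype.ext
  simp [kerProj, hw, hT p]

theorem add_smul_ne_zero (hT : ∀ p : M, Ω p (T p) = 1) (p : M) {w : kerFiber Ω p} (hw : w ≠ 0)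
    (t : ℝ) : (w : TangentSpace 𝓘(ℝ, E) p) + t • T p ≠ 0 := fun h0 => hw <| by
  have h1 := kerProj_add_smul hT p w t
  rw [h0] at h1
  rw [← h1]
  apply Subtype.ext
  simp [kerProj]

theorem eq_of_isAssociatedCone (hT : ∀ p : M, Ω p (T p) = 1) {F F' : ∀ p : M, kerFiber Ω p → ℝ}
    (h0 : ∀ p, F p 0 = 0) (h0' : ∀ p, F' p 0 = 0) (hF : IsAssociatedCone Ω T hT F C)
    (hF' : IsAssociatedCone Ω T hT F' C) : F = F' := by
  funext p w
  by_cases hw : w = 0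
  · rw [hw, h0, h0']
  have hne := add_smul_ne_zero hT p hw (F p w)
  have hC := (hF p _ hne).2 (by rw [kerProj_add_smul, add_comm])
  have h1 := (hF' p _ hne).1 hC
  rw [kerProj_add_smul, add_comm] at h1
  have h2 := congrArg (Ω p) (add_right_cancel h1)
  simpa [hT p] using h2

variable [IsManifold 𝓘(ℝ, E) 1 M] {k : ℕ∞ω}

theorem IsConeStructure.existsUnique_finslerMetric (hdim : 2 ≤ Module.finrank ℝ E)
    [ContMDiffVectorBundle k E (TangentSpace 𝓘(ℝ, E) : M → Type _) 𝓘(ℝ, E)]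
    [IsManifold 𝓘(ℝ, E) k M] (hk : 2 ≤ k) (hC : IsConeStructure k C)
    (hΩ : IsTimelikeOneForm k C Ω) (hTL : IsTimelikeVectorField k C T)
    (hT : ∀ p : M, Ω p (T p) = 1) :
    ∃! F : ∀ p : M, kerFiber Ω p → ℝ, IsFinslerMetric k Ω F ∧ IsAssociatedCone Ω T hT F C := by
  have hk1 : 1 ≤ k := le_trans (by norm_num) hk
  have : FiniteDimensional ℝ E := Module.finite_of_finrank_pos (by omega)
  have hconic : ∀ p, ∀ v ∈ coneFiber C p, ∀ c : ℝ, 0 < c → c • v ∈ coneFiber C p :=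
    fun p => (hC.strongCone p).conic
  have hpos : ∀ p : M, ∀ v : E, v ∈ coneInterior (coneFiber C p) ∨ v ∈ coneFiber C p →
      0 < Ω p v := fun p v hv => hΩ.pos ⟨p, v⟩ hv
  have hA : ∀ p : M, IsConeInterior (coneFiber C p) (coneInterior (coneFiber C p)) := fun p => by
    -- Dimension at least two enters here: uniqueness of the interior needs a nonzero vector of `ker
    -- Ω_p`.
    obtain ⟨b, hb, hb0⟩ := exists_ne_zero_apply_eq_zero hdim (Ω p : E →L[ℝ] ℝ)
    exact isConeInterior_coneInterior (hC.strongCone p).convex_interior (hC.strongCone p).nonempty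
      (hconic p) (θ := Ω p) (hpos p) hb hb0
  have hTA : ∀ p, T p ∈ coneInterior (coneFiber C p) := hTL.timelike
  have hex : ∀ (p : M) (w : kerFiber Ω p), w ≠ 0 →
      ∃ t : ℝ, (w : TangentSpace 𝓘(ℝ, E) p) + t • T p ∈ coneFiber C p := fun p w hw =>
    (hA p).exists_add_smul_mem (hconic p) (hpos p) (hTA p) (fun h => hw (Subtype.ext h)) w.2
  classical
  let F : ∀ p : M, kerFiber Ω p → ℝ := fun p w => if hw : w = 0 then 0 else (hex p w hw).choose
  have hF0 : ∀ p, F p 0 = 0 := fun p => dif_pos rfl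
  have hFC : ∀ (p : M) (w : kerFiber Ω p), w ≠ 0 →
      (w : TangentSpace 𝓘(ℝ, E) p) + F p w • T p ∈ coneFiber C p := fun p w hw => by
    have : F p w = (hex p w hw).choose := dif_neg hw
    rw [this]
    exact (hex p w hw).choose_spec
  -- Homogeneity, smoothness and the association with `C` all come from this uniqueness. At `w = 0`
  -- it is vacuous, since the line of `T_p` misses the cone.
  have hFu : ∀ (p : M) (w : kerFiber Ω p) (t : ℝ),
      (w : TangentSpace 𝓘(ℝ, E) p) + t • T p ∈ coneFiber C p → t = F p w := fun p w t ht => by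
    by_cases hw : w = 0
    · refine absurd ht ?_
      rw [hw, Submodule.coe_zero, zero_add]
      exact (hA p).smul_notMem (hconic p) (hpos p) (hTA p) t
    · exact (hA p).eq_of_add_smul_mem (hconic p) (hTA p) ht (hFC p w hw)
  have hFpos : ∀ (p : M) (w : kerFiber Ω p), w ≠ 0 → 0 < F p w := fun p w hw => by
    have h1 := hpos p _ (Or.inr (hFC p w hw))
    have hw0 : Ω p w = 0 := w.2
    rwa [map_add, map_smul, hw0, hT p, zero_add, smul_eq_mul, mul_one] at h1
  have hassoc : IsAssociatedCone Ω T hT F C := fun p v hv => by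
    have hdec : v = (kerProj Ω T hT p v : TangentSpace 𝓘(ℝ, E) p) + Ω p v • T p := by
      simp [kerProj]
    constructor
    · intro hvC
      rw [hdec] at hvC
      have h1 := hFu p _ _ hvC
      rw [← h1, add_comm]
      exact hdec
    · intro hvF
      have hw : kerProj Ω T hT p v ≠ 0 := fun h0 => hv <| by
        rw [h0, hF0] at hvF
        simpa using hvF
      have h1 := hFC p _ hw
      rw [add_comm, ← hvF] at h1
      exact h1
  refine ⟨F, ⟨⟨fun p w hw => ?_, fun p => ⟨hF0 p, hFpos p, fun c w hc => ?_, fun w hw u hu => ?_⟩⟩,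
    hassoc⟩, fun F' hF' => eq_of_isAssociatedCone hT (fun p => (hF'.1.minkowski p).map_zero) hF0
      hF'.2 hassoc⟩
  · obtain ⟨U, G, hU, hwU, hG, hUG⟩ := hC.exists_contMDiffOn hk1 hTL.contDiff (hA p) (hTA p)
      (hFC p w hw)
    exact ⟨U, G, hU, hwU, hG, fun q x hx => (hFu q x _ (hUG _ hx)).symm⟩
  · by_cases hw : w = 0
    · rw [hw, smul_zero, hF0, mul_zero]
    · refine (hFu p (c • w) _ ?_).symm
      have h1 := hconic p _ (hFC p w hw) c hc
      have h2 : (((c • w : kerFiber Ω p) : TangentSpace 𝓘(ℝ, E) p) + (c * F p w) • T p) =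
          c • ((w : TangentSpace 𝓘(ℝ, E) p) + F p w • T p) := by
        rw [smul_add, smul_smul, Submodule.coe_smul]
      rw [h2]
      exact h1
  · exact fundamentalTensor_pos_of_isStronglyConvexAt hk (hA p) (hconic p) (hTA p) (hT p) (hFu p)
      (hFC p w hw) (hFpos p w hw) ((hC.strongCone p).strongly_convex _ (hFC p w hw)) hu

end Manifold

end ConeGeometry

/-! ### Minkowski norms pulled back to the whole vector space, and their strong cones -/

namespace ConeGeometry

section CylindricalNorm

variable {V : Type*} [NormedAddCommGroup V] [NormedSpace ℝ V]

/-- The projection of `V = ℝ T ⊕ ker θ` onto `ker θ`, as an endomorphism of `V`. -/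
noncomputable def projKer (θ : V →L[ℝ] ℝ) (T : V) : V →L[ℝ] V :=
  ContinuousLinearMap.id ℝ V - θ.smulRight T

theorem projKer_apply (θ : V →L[ℝ] ℝ) (T v : V) : projKer θ T v = v - θ v • T := rfl

theorem apply_projKer {θ : V →L[ℝ] ℝ} {T : V} (hT : θ T = 1) (v : V) : θ (projKer θ T v) = 0 := by
  simp [projKer_apply, hT]

theorem projKer_add_smul {θ : V →L[ℝ] ℝ} {T : V} (v : V) :
    projKer θ T v + θ v • T = v := by
  simp [projKer_apply]

theorem projKer_self {θ : V →L[ℝ] ℝ} {T : V} (hT : θ T = 1) : projKer θ T T = 0 := by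
  simp [projKer_apply, hT]

theorem projKer_of_apply_eq_zero {θ : V →L[ℝ] ℝ} {T w : V} (hw : θ w = 0) :
    projKer θ T w = w := by
  simp [projKer_apply, hw]

/-- The pull-backs to `V = ℝ T ⊕ ker θ` of the Minkowski norms of class `C^k` on `ker θ`. -/
structure IsCylindricalNorm (k : ℕ∞ω) (θ : V →L[ℝ] ℝ) (T : V) (H : V → ℝ) : Prop where
  unit : θ T = 1
  map_zero : H 0 = 0
  map_add_smul : ∀ (v : V) (t : ℝ), H (v + t • T) = H v
  pos : ∀ v : V, projKer θ T v ≠ 0 → 0 < H v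
  homogeneous : ∀ (c : ℝ) (v : V), 0 < c → H (c • v) = c * H v
  contDiffOn : ContDiffOn ℝ k H {v | projKer θ T v ≠ 0}
  posDef : ∀ v : V, projKer θ T v ≠ 0 → ∀ u : V, θ u = 0 → u ≠ 0 →
    0 < fderiv ℝ H v u ^ 2 + H v * fderiv ℝ (fderiv ℝ H) v u u

namespace IsCylindricalNorm

variable {k : ℕ∞ω} {θ : V →L[ℝ] ℝ} {T : V} {H : V → ℝ} {v : V}

theorem isOpen_setOf : IsOpen {v | projKer θ T v ≠ 0} :=
  isOpen_ne_fun (projKer θ T).continuous continuous_const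

theorem contDiffAt (h : IsCylindricalNorm k θ T H) (hv : projKer θ T v ≠ 0) : ContDiffAt ℝ k H v :=
  h.contDiffOn.contDiffAt (isOpen_setOf.mem_nhds hv)

theorem hasFDerivAt (h : IsCylindricalNorm k θ T H) (hk : 2 ≤ k) (hv : projKer θ T v ≠ 0) :
    HasFDerivAt H (fderiv ℝ H v) v :=
  (((h.contDiffAt hv).of_le hk).differentiableAt (by norm_num)).hasFDerivAt

theorem hasFDerivAt_fderiv (h : IsCylindricalNorm k θ T H) (hk : 2 ≤ k) (hv : projKer θ T v ≠ 0) :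
    HasFDerivAt (fderiv ℝ H) (fderiv ℝ (fderiv ℝ H) v) v :=
  ((((h.contDiffAt hv).of_le hk).fderiv_right (m := 1) (by norm_num)).differentiableAt
    (by norm_num)).hasFDerivAt

theorem map_smul_self (h : IsCylindricalNorm k θ T H) (t : ℝ) : H (t • T) = 0 := by
  simpa [h.map_zero] using h.map_add_smul 0 t

theorem nonneg (h : IsCylindricalNorm k θ T H) (v : V) : 0 ≤ H v := by
  by_cases hv : projKer θ T v = 0
  · rw [← projKer_add_smul (θ := θ) (T := T) v, hv, zero_add, h.map_smul_self]
  · exact (h.pos v hv).le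

theorem map_projKer (h : IsCylindricalNorm k θ T H) (v : V) : H (projKer θ T v) = H v := by
  conv_rhs => rw [← projKer_add_smul (θ := θ) (T := T) v, h.map_add_smul]

theorem fderiv_apply_transverse (h : IsCylindricalNorm k θ T H) (hk : 2 ≤ k)
    (hv : projKer θ T v ≠ 0) : fderiv ℝ H v T = 0 := by
  have h1 : HasDerivAt (fun t : ℝ => v + t • T) T 0 := by
    simpa using ((hasDerivAt_id (0 : ℝ)).smul_const T).const_add v
  have h2 := HasFDerivAt.comp_hasDerivAt (x := (0 : ℝ)) (f := fun t : ℝ => v + t • T)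
    (by simpa using h.hasFDerivAt hk hv) h1
  have h3 : H ∘ (fun t : ℝ => v + t • T) = fun _ => H v := funext fun t => h.map_add_smul v t
  rw [h3] at h2
  exact h2.unique (hasDerivAt_const _ _)

theorem fderiv_apply_self (h : IsCylindricalNorm k θ T H) (hk : 2 ≤ k)
    (hv : projKer θ T v ≠ 0) : fderiv ℝ H v v = H v := by
  have h1 : HasDerivAt (fun t : ℝ => t • v) v 1 := by
    simpa using (hasDerivAt_id (1 : ℝ)).smul_const v
  have h2 := HasFDerivAt.comp_hasDerivAt (x := (1 : ℝ)) (f := fun t : ℝ => t • v)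
    (by simpa using h.hasFDerivAt hk hv) h1
  have h3 : H ∘ (fun t : ℝ => t • v) =ᶠ[𝓝 1] fun t => t * H v := by
    filter_upwards [lt_mem_nhds one_pos] with t ht using h.homogeneous t v ht
  have h4 : HasDerivAt (fun t : ℝ => t * H v) (H v) 1 := by
    simpa using (hasDerivAt_id (1 : ℝ)).mul_const (H v)
  exact (h2.congr_of_eventuallyEq h3.symm).unique h4

theorem fderiv_add_smul (h : IsCylindricalNorm k θ T H) (v : V) (t : ℝ) :
    fderiv ℝ H (v + t • T) = fderiv ℝ H v := by
  rw [← fderiv_comp_add_right]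
  congr 1
  exact funext fun x => h.map_add_smul x t

theorem fderiv_smul (h : IsCylindricalNorm k θ T H) (v : V) {c : ℝ} (hc : 0 < c) :
    fderiv ℝ H (c • v) = fderiv ℝ H v := by
  have h1 := fderiv_comp_smul (𝕜 := ℝ) (f := H) (x := v) c
  have h2 : (fun x => H (c • x)) = fun x => c * H x := funext fun x => h.homogeneous c x hc
  have h3 : fderiv ℝ (fun x => c * H x) v = c • fderiv ℝ H v := by
    have : (fun x => c * H x) = c • H := rfl
    rw [this, fderiv_const_smul_field, Pi.smul_apply]
  rw [h2, h3] at h1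
  exact (smul_right_injective _ hc.ne' h1).symm

theorem fderiv_fderiv_transverse (h : IsCylindricalNorm k θ T H) (hk : 2 ≤ k)
    (hv : projKer θ T v ≠ 0) : fderiv ℝ (fderiv ℝ H) v T = 0 := by
  have h1 : HasDerivAt (fun t : ℝ => v + t • T) T 0 := by
    simpa using ((hasDerivAt_id (0 : ℝ)).smul_const T).const_add v
  have h2 := HasFDerivAt.comp_hasDerivAt (x := (0 : ℝ)) (f := fun t : ℝ => v + t • T)
    (by simpa using h.hasFDerivAt_fderiv hk hv) h1
  have h3 : fderiv ℝ H ∘ (fun t : ℝ => v + t • T) = fun _ => fderiv ℝ H v :=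
    funext fun t => h.fderiv_add_smul v t
  rw [h3] at h2
  exact h2.unique (hasDerivAt_const _ _)

theorem fderiv_fderiv_self (h : IsCylindricalNorm k θ T H) (hk : 2 ≤ k)
    (hv : projKer θ T v ≠ 0) : fderiv ℝ (fderiv ℝ H) v v = 0 := by
  have h1 : HasDerivAt (fun t : ℝ => t • v) v 1 := by
    simpa using (hasDerivAt_id (1 : ℝ)).smul_const v
  have h2 := HasFDerivAt.comp_hasDerivAt (x := (1 : ℝ)) (f := fun t : ℝ => t • v)
    (by simpa using h.hasFDerivAt_fderiv hk hv) h1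
  have h3 : fderiv ℝ H ∘ (fun t : ℝ => t • v) =ᶠ[𝓝 1] fun _ => fderiv ℝ H v := by
    filter_upwards [lt_mem_nhds one_pos] with t ht using h.fderiv_smul v ht
  exact (h2.congr_of_eventuallyEq h3.symm).unique (hasDerivAt_const _ _)

theorem fderiv_fderiv_symm (h : IsCylindricalNorm k θ T H) (hk : 2 ≤ k)
    (hv : projKer θ T v ≠ 0) (a b : V) :
    fderiv ℝ (fderiv ℝ H) v a b = fderiv ℝ (fderiv ℝ H) v b a :=
  (((h.contDiffAt hv).of_le hk).isSymmSndFDerivAt (by simp)).eq a b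

/-- The second derivative of the norm is positive semi-definite, with radical `span(v, T)`. -/
theorem fderiv_fderiv_nonneg (h : IsCylindricalNorm k θ T H) (hk : 2 ≤ k)
    (hv : projKer θ T v ≠ 0) (u : V) : 0 ≤ fderiv ℝ (fderiv ℝ H) v u u ∧
      (fderiv ℝ (fderiv ℝ H) v u u = 0 → ∃ c : ℝ, projKer θ T u = c • projKer θ T v) := by
  have hH := h.pos v hv
  -- This `c` gives `dH(u') = 0`, so `posDef` at `u'` reduces to `H D²H(u', u') > 0`. The correction
  -- `u' - u` lies in the span of `v` and `T`, which `D²H` annihilates.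
  set c := fderiv ℝ H v u / H v with hc
  set u' := projKer θ T u - c • projKer θ T v with hu'
  have hdecomp : u' = u + (-c) • v + (-θ u + c * θ v) • T := by
    rw [hu', projKer_apply, projKer_apply]
    module
  have hD : fderiv ℝ H v u' = 0 := by
    rw [hdecomp, map_add, map_add, map_smul, map_smul, h.fderiv_apply_transverse hk hv,
      h.fderiv_apply_self hk hv, hc, smul_eq_mul]
    field_simp
    simp
  have hB : ∀ y, fderiv ℝ (fderiv ℝ H) v u' y = fderiv ℝ (fderiv ℝ H) v u y := fun y => by
    rw [hdecomp, map_add, map_add, map_smul, map_smul, h.fderiv_fderiv_transverse hk hv,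
      h.fderiv_fderiv_self hk hv, smul_zero, smul_zero, add_zero, add_zero]
  have hBB : fderiv ℝ (fderiv ℝ H) v u' u' = fderiv ℝ (fderiv ℝ H) v u u := by
    rw [hB, h.fderiv_fderiv_symm hk hv, hB]
  by_cases hu0 : u' = 0
  · rw [← hBB, hu0, _root_.map_zero]
    exact ⟨le_rfl, fun _ => ⟨c, sub_eq_zero.1 hu0⟩⟩
  · have h1 := h.posDef v hv u' (by
      rw [hu', map_sub, map_smul, apply_projKer h.unit, apply_projKer h.unit]; simp) hu0
    rw [hD, hBB, zero_pow two_ne_zero, zero_add] at h1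
    have h2 := pos_of_mul_pos_right h1 hH.le
    exact ⟨h2.le, fun h0 => absurd h0 h2.ne'⟩

/-- If the segment from `v` to `x` avoids the line `ℝ T`, `H` is convex along it, and its initial
slope gives `dH_v(x - v) ≤ H x - H v`; Euler's identity `dH_v(v) = H v` finishes. Otherwise `x` is a
nonpositive multiple of `v` modulo `T`, and `dH_v(x) ≤ 0 ≤ H x`. -/
theorem fderiv_apply_le (h : IsCylindricalNorm k θ T H) (hk : 2 ≤ k)
    (hv : projKer θ T v ≠ 0) (x : V) : fderiv ℝ H v x ≤ H x := by
  by_cases hx : ∃ c : ℝ, 0 ≤ c ∧ projKer θ T x = (-c) • projKer θ T v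
  · obtain ⟨c, hc, hxc⟩ := hx
    have hdec : x = (-c) • v + (θ x + c * θ v) • T := by
      conv_lhs => rw [← projKer_add_smul (θ := θ) (T := T) x, hxc, projKer_apply]
      module
    have h1 : fderiv ℝ H v x = -c * H v := by
      conv_lhs => rw [hdec]
      rw [map_add, map_smul, map_smul, h.fderiv_apply_transverse hk hv, h.fderiv_apply_self hk hv]
      simp
    rw [h1]
    nlinarith [h.nonneg x, h.nonneg v]
  · set γ : ℝ → V := fun s => v + s • (x - v) with hγ
    have hne : ∀ s ∈ Icc (0 : ℝ) 1, projKer θ T (γ s) ≠ 0 := fun s hs h0 => by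
      have h1 : (1 - s) • projKer θ T v + s • projKer θ T x = 0 := by
        rw [← h0, hγ]
        simp only [map_add, map_smul, map_sub]
        module
      rcases eq_or_lt_of_le hs.1 with hs0 | hs0
      · rw [← hs0] at h1
        exact hv (by simpa using h1)
      · refine hx ⟨(1 - s) / s, div_nonneg (sub_nonneg.2 hs.2) hs0.le, ?_⟩
        have h2 : s • projKer θ T x = s • (-((1 - s) / s)) • projKer θ T v := by
          rw [smul_smul, mul_neg, mul_div_cancel₀ _ hs0.ne', neg_smul]
          exact eq_neg_of_add_eq_zero_right h1
        exact smul_right_injective _ hs0.ne' h2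
    have hdγ : ∀ s, HasDerivAt γ (x - v) s := fun s => by
      have := ((hasDerivAt_id s).smul_const (x - v)).const_add v
      rwa [one_smul] at this
    have hd1 : ∀ s, projKer θ T (γ s) ≠ 0 →
        HasDerivAt (H ∘ γ) (fderiv ℝ H (γ s) (x - v)) s := fun s hs =>
      (h.hasFDerivAt hk hs).comp_hasDerivAt s (hdγ s)
    have hd2 : ∀ s, projKer θ T (γ s) ≠ 0 →
        HasDerivAt (deriv (H ∘ γ)) (fderiv ℝ (fderiv ℝ H) (γ s) (x - v) (x - v)) s := fun s hs => by
      have h1 : HasDerivAt (fun s => fderiv ℝ H (γ s) (x - v))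
          (fderiv ℝ (fderiv ℝ H) (γ s) (x - v) (x - v)) s := by
        have := ((h.hasFDerivAt_fderiv hk hs).comp_hasDerivAt s (hdγ s)).clm_apply
          (hasDerivAt_const s (x - v))
        simpa using this
      refine h1.congr_of_eventuallyEq ?_
      filter_upwards [(hdγ s).continuousAt.preimage_mem_nhds (isOpen_setOf.mem_nhds hs)] with r hr
      exact (hd1 r hr).deriv
    have hconv : ConvexOn ℝ (Icc 0 1) (H ∘ γ) := by
      refine convexOn_of_deriv2_nonneg' (convex_Icc 0 1)
        (fun s hs => (hd1 s (hne s hs)).differentiableAt.differentiableWithinAt)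
        (fun s hs => (hd2 s (hne s hs)).differentiableAt.differentiableWithinAt) fun s hs => ?_
      rw [Function.iterate_succ_apply, Function.iterate_one, (hd2 s (hne s hs)).deriv]
      exact (h.fderiv_fderiv_nonneg hk (hne s hs) _).1
    have h0 : (0 : ℝ) ∈ Icc (0 : ℝ) 1 := by simp
    have hle := hconv.le_slope_of_hasDerivAt h0 (by simp) one_pos (hd1 0 (hne 0 h0))
    have hγ0 : γ 0 = v := by simp [hγ]
    have hγ1 : γ 1 = x := by simp [hγ]
    rw [slope_def_field, Function.comp_apply, Function.comp_apply, hγ0, hγ1, map_sub,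
      h.fderiv_apply_self hk hv] at hle
    linarith

/-- Euler's identity at `x + y` writes the left side as a linear functional of `x + y`, and that
functional is bounded by `H` on each summand. -/
theorem map_add_le (h : IsCylindricalNorm k θ T H) (hk : 2 ≤ k) (x y : V) :
    H (x + y) ≤ H x + H y := by
  by_cases hxy : projKer θ T (x + y) = 0
  · rw [← projKer_add_smul (θ := θ) (T := T) (x + y), hxy, zero_add, h.map_smul_self]
    exact add_nonneg (h.nonneg x) (h.nonneg y)
  · rw [← h.fderiv_apply_self hk hxy, map_add]
    exact add_le_add (h.fderiv_apply_le hk hxy x) (h.fderiv_apply_le hk hxy y)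

theorem map_smul_of_nonneg (h : IsCylindricalNorm k θ T H) {c : ℝ} (hc : 0 ≤ c) (v : V) :
    H (c • v) = c * H v := by
  rcases hc.eq_or_lt with rfl | hc
  · rw [zero_smul, h.map_zero, zero_mul]
  · exact h.homogeneous c v hc

theorem convexOn (h : IsCylindricalNorm k θ T H) (hk : 2 ≤ k) : ConvexOn ℝ univ H := by
  refine ⟨convex_univ, fun x _ y _ a b ha hb _ => ?_⟩
  rw [smul_eq_mul, smul_eq_mul, ← h.map_smul_of_nonneg ha, ← h.map_smul_of_nonneg hb]
  exact h.map_add_le hk _ _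

/-- Differentiability is assumed only off the line `ℝ T`; convexity supplies continuity across it.
-/
theorem continuous [FiniteDimensional ℝ V] (h : IsCylindricalNorm k θ T H) (hk : 2 ≤ k) :
    Continuous H :=
  (h.convexOn hk).locallyLipschitz.continuous

/-- The cone avoids the line `ℝ T`, where `H` vanishes and may fail to be smooth. -/
theorem projKer_ne_zero (h : IsCylindricalNorm k θ T H) (hv : v ≠ 0) (hC : θ v = H v) :
    projKer θ T v ≠ 0 := fun h0 => by
  have h1 := h.map_projKer v
  rw [h0, h.map_zero, ← hC] at h1
  have h2 := projKer_add_smul (θ := θ) (T := T) v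
  rw [h0, ← h1, zero_smul, zero_add] at h2
  exact hv h2.symm

theorem isConeInterior [FiniteDimensional ℝ V] (h : IsCylindricalNorm k θ T H) (hk : 2 ≤ k) :
    IsConeInterior {v | v ≠ 0 ∧ θ v = H v} {v | H v < θ v} where
  isOpen := isOpen_lt (h.continuous hk) θ.continuous
  zero_notMem := by simp [h.map_zero]
  convex := by
    intro x (hx : H x < θ x) y (hy : H y < θ y) a b ha hb hab
    have h1 := h.map_add_le hk (a • x) (b • y)
    rw [h.map_smul_of_nonneg ha, h.map_smul_of_nonneg hb] at h1
    rw [mem_ofPred_eq, map_add, map_smul, map_smul, smul_eq_mul, smul_eq_mul]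
    rcases ha.eq_or_lt with rfl | ha
    · have hb1 : b = 1 := by linarith
      subst hb1
      linarith
    · nlinarith [mul_lt_mul_of_pos_left hx ha, mul_le_mul_of_nonneg_left hy.le hb]
  boundary_eq := by
    have hopen : IsOpen {v | H v < θ v} := isOpen_lt (h.continuous hk) θ.continuous
    rw [hopen.frontier_eq]
    ext v
    have hcl : v ∈ closure {v | H v < θ v} ↔ H v ≤ θ v := by
      constructor
      · exact fun hv => closure_lt_subset_le (h.continuous hk) θ.continuous hv
      · intro hv
        -- Moving along `T` raises `θ` and leaves `H` fixed, so it turns `H v ≤ θ v` into a strict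
        -- inequality.
        have hlim : Tendsto (fun t : ℝ => v + t • T) (𝓝[>] 0) (𝓝 v) := by
          have : ContinuousAt (fun t : ℝ => v + t • T) 0 := by fun_prop
          simpa [ContinuousAt] using this.tendsto.mono_left nhdsWithin_le_nhds
        refine mem_closure_of_tendsto hlim ?_
        filter_upwards [self_mem_nhdsWithin] with t ht
        have ht : 0 < t := ht
        simp only [h.map_add_smul, map_add, map_smul, h.unit, smul_eq_mul]
        linarith
    simp only [mem_ofPred_eq, Set.mem_sdiff, mem_singleton_iff, hcl, not_lt]
    exact ⟨fun hv => ⟨⟨hv.2.ge, hv.2.le⟩, hv.1⟩, fun hv => ⟨hv.2, le_antisymm hv.1.2 hv.1.1⟩⟩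

theorem fderiv_sub (h : IsCylindricalNorm k θ T H) (hk : 2 ≤ k) (hv : projKer θ T v ≠ 0) :
    fderiv ℝ (fun x => θ x - H x) v = θ - fderiv ℝ H v :=
  (θ.hasFDerivAt.sub (h.hasFDerivAt hk hv)).fderiv

theorem fderiv_fderiv_sub (h : IsCylindricalNorm k θ T H) (hk : 2 ≤ k) (hv : projKer θ T v ≠ 0) :
    fderiv ℝ (fderiv ℝ (fun x => θ x - H x)) v = -fderiv ℝ (fderiv ℝ H) v := by
  have h1 : fderiv ℝ (fun x => θ x - H x) =ᶠ[𝓝 v] fun x => θ - fderiv ℝ H x := by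
    filter_upwards [isOpen_setOf.mem_nhds hv] with x hx using h.fderiv_sub hk hx
  rw [h1.fderiv_eq]
  exact ((h.hasFDerivAt_fderiv hk hv).const_sub θ).fderiv

theorem isDefiningFunctionAt (h : IsCylindricalNorm k θ T H) (hk : 2 ≤ k)
    (hv : projKer θ T v ≠ 0) :
    IsDefiningFunctionAt 𝓘(ℝ, V) k {v | v ≠ 0 ∧ θ v = H v} (fun x => θ x - H x) v := by
  refine ⟨⟨_, isOpen_setOf, hv, (θ.contDiff.contDiffOn.sub h.contDiffOn).contMDiffOn,
    fun y hy => ?_⟩, ?_⟩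
  · have hy0 : y ≠ 0 := fun h0 => hy (by rw [h0, _root_.map_zero])
    simp [hy0, sub_eq_zero]
  · rw [mfderiv_eq_fderiv, h.fderiv_sub hk hv]
    intro h0
    have h1 : θ = fderiv ℝ H v := sub_eq_zero.1 h0
    have := DFunLike.congr_fun h1 T
    rw [h.unit, h.fderiv_apply_transverse hk hv] at this
    exact one_ne_zero this

theorem isStrongCone [FiniteDimensional ℝ V] (hdim : 2 ≤ Module.finrank ℝ V)
    (h : IsCylindricalNorm k θ T H) (hk : 2 ≤ k) : IsStrongCone k {v | v ≠ 0 ∧ θ v = H v} where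
  nonempty := by
    obtain ⟨b, hb, hb0⟩ := exists_ne_zero_apply_eq_zero hdim θ
    refine ⟨b + H b • T, fun h0 => hb ?_, ?_⟩
    · have h1 := congrArg (projKer θ T) h0
      rwa [map_add, map_smul, projKer_self h.unit, projKer_of_apply_eq_zero hb0, smul_zero,
        add_zero, _root_.map_zero] at h1
    · rw [h.map_add_smul, map_add, map_smul, hb0, h.unit, zero_add, smul_eq_mul, mul_one]
  zero_notMem := fun h0 => h0.1 rfl
  hypersurface := fun v hv => ⟨_, h.isDefiningFunctionAt hk (h.projKer_ne_zero hv.1 hv.2)⟩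
  conic := fun v hv c hc => ⟨smul_ne_zero hc.ne' hv.1, by
    rw [map_smul, h.homogeneous c v hc, hv.2, smul_eq_mul]⟩
  salient := fun v hv hneg => by
    have h1 := h.pos v (h.projKer_ne_zero hv.1 hv.2)
    have h2 := h.nonneg (-v)
    rw [← hneg.2, map_neg, hv.2] at h2
    linarith
  convex_interior := ⟨_, h.isConeInterior hk⟩
  strongly_convex := fun v hv => by
    have hpv := h.projKer_ne_zero hv.1 hv.2
    have hDT := h.fderiv_apply_transverse hk hpv
    have hII : ∀ u w, secondFundamentalForm (fun x => θ x - H x) v T u w =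
        fderiv ℝ (fderiv ℝ H) v u w := fun u w => by
      rw [secondFundamentalForm, h.fderiv_sub hk hpv, h.fderiv_fderiv_sub hk hpv]
      simp [hDT, h.unit]
    refine ⟨fun x => θ x - H x, T, h.isDefiningFunctionAt hk hpv, ?_, ?_, ?_, ?_⟩
    · rw [h.fderiv_sub hk hpv]
      simp [hDT, h.unit]
    · filter_upwards [self_mem_nhdsWithin] with t ht
      have ht : 0 < t := ht
      refine ⟨_, h.isConeInterior hk, ?_⟩
      simp only [mem_ofPred_eq, h.map_add_smul, map_add, map_smul, h.unit, smul_eq_mul, hv.2]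
      linarith
    · intro u _
      rw [hII]
      exact (h.fderiv_fderiv_nonneg hk hpv u).1
    · intro u hu
      constructor
      · intro hrad
        have h1 := hrad u hu
        rw [hII] at h1
        obtain ⟨c, hc⟩ := (h.fderiv_fderiv_nonneg hk hpv u).2 h1
        refine ⟨c, ?_⟩
        -- The Hessian determines `u` only modulo `T`. Tangency, `θ u = dH_v(u)`, fixes the
        -- `T`-component as `c θ v`, so that `u = c v`.
        rw [h.fderiv_sub hk hpv, sub_apply, sub_eq_zero] at hu
        have hDπ : ∀ x, fderiv ℝ H v (projKer θ T x) = fderiv ℝ H v x := fun x => by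
          rw [projKer_apply, map_sub, map_smul, hDT, smul_zero, sub_zero]
        have hθ : θ u = c * θ v := by
          rw [hu, ← hDπ u, hc, map_smul, hDπ v, h.fderiv_apply_self hk hpv, hv.2, smul_eq_mul]
        rw [← projKer_add_smul (θ := θ) (T := T) u, hc, hθ, mul_smul, ← smul_add, projKer_add_smul]
      · rintro ⟨c, rfl⟩ w _
        rw [hII, map_smul, h.fderiv_fderiv_self hk hpv, smul_zero, zero_apply]

end IsCylindricalNorm

end CylindricalNorm

end ConeGeometry

/-! ### From cone triples to cone structures -/

namespace ConeGeometry

section Manifold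

variable {E : Type*} [NormedAddCommGroup E] [NormedSpace ℝ E]
  {M : Type*} [TopologicalSpace M] [ChartedSpace E M]
  {Ω : ∀ p : M, TangentSpace 𝓘(ℝ, E) p →L[ℝ] ℝ}
  {T : ∀ p : M, TangentSpace 𝓘(ℝ, E) p} {F : ∀ p : M, kerFiber Ω p → ℝ}

/-- The hypersurface `Ω(v) = F(π(v))` of `TM ∖ 0`. -/
def graphCone (Ω : ∀ p : M, TangentSpace 𝓘(ℝ, E) p →L[ℝ] ℝ) (T : ∀ p : M, TangentSpace 𝓘(ℝ, E) p)
    (hT : ∀ p : M, Ω p (T p) = 1) (F : ∀ p : M, kerFiber Ω p → ℝ) :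
    Set (TangentBundle 𝓘(ℝ, E) M) :=
  {x | x.snd ≠ 0 ∧ Ω x.proj x.snd = F x.proj (kerProj Ω T hT x.proj x.snd)}

theorem isAssociatedCone_graphCone (hT : ∀ p : M, Ω p (T p) = 1) :
    IsAssociatedCone Ω T hT F (graphCone Ω T hT F) := fun p v hv => by
  have hdec : v = Ω p v • T p + (kerProj Ω T hT p v : TangentSpace 𝓘(ℝ, E) p) := by
    simp [kerProj]
  constructor
  · rintro ⟨-, h⟩
    rw [← show Ω p v = F p (kerProj Ω T hT p v) from h]
    exact hdec
  · intro h
    refine ⟨hv, ?_⟩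
    have h1 := congrArg (Ω p) (add_right_cancel (hdec.symm.trans h))
    simpa [hT p] using h1

theorem kerProj_zero (hT : ∀ p : M, Ω p (T p) = 1) (p : M) : kerProj Ω T hT p 0 = 0 := by
  apply Subtype.ext
  simp [kerProj]

theorem kerProj_add (hT : ∀ p : M, Ω p (T p) = 1) (p : M) (v w : TangentSpace 𝓘(ℝ, E) p) :
    kerProj Ω T hT p (v + w) = kerProj Ω T hT p v + kerProj Ω T hT p w := by
  apply Subtype.ext
  simp only [kerProj, Submodule.coe_add, map_add]
  module

theorem kerProj_smul (hT : ∀ p : M, Ω p (T p) = 1) (p : M) (c : ℝ) (v : TangentSpace 𝓘(ℝ, E) p) :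
    kerProj Ω T hT p (c • v) = c • kerProj Ω T hT p v := by
  apply Subtype.ext
  simp only [kerProj, Submodule.coe_smul, map_smul]
  module

theorem kerProj_of_mem (hT : ∀ p : M, Ω p (T p) = 1) (p : M) (w : kerFiber Ω p) :
    kerProj Ω T hT p w = w := by
  have hw : Ω p w = 0 := w.2
  apply Subtype.ext
  simp [kerProj, hw]

theorem kerProj_field (hT : ∀ p : M, Ω p (T p) = 1) (p : M) : kerProj Ω T hT p (T p) = 0 := by
  apply Subtype.ext
  simp [kerProj, hT p]

variable [IsManifold 𝓘(ℝ, E) 1 M] {k : ℕ∞ω}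

/-- Smoothness comes from composing the local extensions of `F` with the smooth map `π`. Positivity
comes from computing the fundamental tensor with the derivatives of `H` along lines in directions of
`ker Ω_p`. -/
theorem IsFinslerMetric.isCylindricalNorm
    [ContMDiffVectorBundle k E (TangentSpace 𝓘(ℝ, E) : M → Type _) 𝓘(ℝ, E)] (hk : 2 ≤ k)
    (hF : IsFinslerMetric k Ω F) (hΩ : IsContDiffOneForm k Ω) (hTC : IsContDiffVectorField k T)
    (hT : ∀ p : M, Ω p (T p) = 1) (p : M) :
    IsCylindricalNorm (V := E) k (Ω p) (T p) (fun v : E => F p (kerProj Ω T hT p v)) := by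
  have hM := hF.minkowski p
  have hker : ∀ v : E, projKer (V := E) (Ω p) (T p) v ≠ 0 → kerProj Ω T hT p v ≠ 0 :=
    fun v hv h0 => hv (congrArg Subtype.val h0)
  have hC : ContDiffOn ℝ k (fun v : E => F p (kerProj Ω T hT p v))
      {v | projKer (V := E) (Ω p) (T p) v ≠ 0} := by
    intro v hv
    obtain ⟨U, G, hU, hvU, hG, hGF⟩ := hF.contDiff p _ (hker v hv)
    have hj : ContMDiff 𝓘(ℝ, E) 𝓘(ℝ, E).tangent k (fun x : E =>
        (⟨p, kerProj Ω T hT p x⟩ : TangentBundle 𝓘(ℝ, E) M)) :=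
      (contMDiff_kerProj hΩ hTC hT).comp (contMDiff_fiberInclusion p)
    have h1 : ContMDiffAt 𝓘(ℝ, E) 𝓘(ℝ, ℝ) k (fun x : E => G ⟨p, kerProj Ω T hT p x⟩) v :=
      (hG.contMDiffAt (hU.mem_nhds hvU)).comp v (hj v)
    refine (h1.contDiffAt.congr_of_eventuallyEq ?_).contDiffWithinAt
    filter_upwards [hj.continuous.continuousAt.preimage_mem_nhds (hU.mem_nhds hvU)] with x hx
    exact hGF p _ hx
  have hadd : ∀ (v u : E) (s : ℝ) (hu : Ω p u = 0), kerProj Ω T hT p (v + s • u : E) =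
      kerProj Ω T hT p v + s • (⟨u, hu⟩ : kerFiber Ω p) := fun v u s hu =>
    (kerProj_add hT p v (s • u : E)).trans (congrArg _ ((kerProj_smul hT p s u).trans
      (congrArg (s • ·) (kerProj_of_mem hT p ⟨u, hu⟩))))
  refine ⟨hT p, (congrArg (F p) (kerProj_zero hT p)).trans hM.map_zero, fun v t => ?_,
    fun v hv => hM.pos _ (hker v hv), fun c v hc => ?_, hC, fun v hv u hu hu0 => ?_⟩
  · refine congrArg (F p) ((kerProj_add hT p v (t • T p)).trans ?_)
    rw [kerProj_smul, kerProj_field, smul_zero, add_zero]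
  · exact (congrArg (F p) (kerProj_smul hT p c v)).trans (hM.homogeneous c _ hc)
  · set H : E → ℝ := fun v : E => F p (kerProj Ω T hT p v) with hH
    have hHat : ∀ x ∈ {v | projKer (V := E) (Ω p) (T p) v ≠ 0}, ContDiffAt ℝ 2 H x := fun x hx =>
      (hC.contDiffAt (IsCylindricalNorm.isOpen_setOf.mem_nhds hx)).of_le hk
    set γ : ℝ → E := fun s => v + s • u with hγ
    have hγ0 : γ 0 = v := by simp [hγ]
    have hdγ : ∀ s, HasDerivAt γ u s := fun s => by
      have := ((hasDerivAt_id s).smul_const u).const_add v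
      rwa [one_smul] at this
    have hv0 : γ 0 ∈ {v | projKer (V := E) (Ω p) (T p) v ≠ 0} := hγ0.symm ▸ hv
    have hd1 : ∀ s, γ s ∈ {v | projKer (V := E) (Ω p) (T p) v ≠ 0} →
        HasDerivAt (H ∘ γ) (fderiv ℝ H (γ s) u) s := fun s hs =>
      ((hHat _ hs).differentiableAt (by norm_num)).hasFDerivAt.comp_hasDerivAt s (hdγ s)
    have hd2 : HasDerivAt (deriv (H ∘ γ)) (fderiv ℝ (fderiv ℝ H) (γ 0) u u) 0 := by
      have h1 : DifferentiableAt ℝ (fderiv ℝ H) (γ 0) :=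
        ((hHat _ hv0).fderiv_right (m := 1) (by norm_num)).differentiableAt (by norm_num)
      have h2 : HasDerivAt (fun s => fderiv ℝ H (γ s) u) (fderiv ℝ (fderiv ℝ H) (γ 0) u u) 0 := by
        have := (h1.hasFDerivAt.comp_hasDerivAt 0 (hdγ 0)).clm_apply (hasDerivAt_const 0 u)
        simpa using this
      refine h2.congr_of_eventuallyEq ?_
      filter_upwards [(hdγ 0).continuousAt.preimage_mem_nhds
        (IsCylindricalNorm.isOpen_setOf.mem_nhds hv0)] with r hr
      exact (hd1 r hr).deriv
    have hγC : ContDiff ℝ 2 γ := by fun_prop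
    have hpos := hM.posDef _ (hker v hv) ⟨u, hu⟩ (fun h0 => hu0 (congrArg Subtype.val h0))
    rw [fundamentalTensor_sq (g := H ∘ γ) ((hHat _ hv0).comp 0 hγC.contDiffAt)
      (Eventually.of_forall fun s => congrArg (F p) (hadd v u s hu).symm), hd2.deriv,
      (hd1 0 hv0).deriv, Function.comp_apply, hγ0] at hpos
    exact hpos

theorem IsConeTriple.isConeStructure (hdim : 2 ≤ Module.finrank ℝ E)
    [ContMDiffVectorBundle k E (TangentSpace 𝓘(ℝ, E) : M → Type _) 𝓘(ℝ, E)] (hk : 2 ≤ k)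
    (h : IsConeTriple k Ω T F) : IsConeStructure k (graphCone Ω T h.unit F) := by
  have hk1 : 1 ≤ k := le_trans (by norm_num) hk
  have : ContMDiffVectorBundle 1 E (TangentSpace 𝓘(ℝ, E) : M → Type _) 𝓘(ℝ, E) :=
    ContMDiffVectorBundle.of_le hk1
  have : FiniteDimensional ℝ E := Module.finite_of_finrank_pos (by omega)
  have hH := h.finsler.isCylindricalNorm hk h.contDiff_form h.contDiff_field h.unit
  have key : ∀ (p : M) (v : E), (⟨p, v⟩ : TangentBundle 𝓘(ℝ, E) M) ∈ graphCone Ω T h.unit F →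
      ∃ f : TangentBundle 𝓘(ℝ, E) M → ℝ,
        IsDefiningFunctionAt 𝓘(ℝ, E).tangent k (graphCone Ω T h.unit F) f ⟨p, v⟩ ∧
        fderiv ℝ (fun x : E => f ⟨p, x⟩) v ≠ 0 := by
    rintro p v ⟨hv0, hv⟩
    have hpv := (hH p).projKer_ne_zero hv0 hv
    have hker : kerProj Ω T h.unit p v ≠ 0 := fun h0 => hpv (congrArg Subtype.val h0)
    obtain ⟨U, G, hU, hvU, hG, hGF⟩ := h.finsler.contDiff p _ hker
    have hπ := contMDiff_kerProj h.contDiff_form h.contDiff_field h.unit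
    have hΩ := h.contDiff_form.contMDiff_apply
    have hpos : 0 < Ω p v := by
      rw [show Ω p v = F p (kerProj Ω T h.unit p v) from hv]
      exact (hH p).pos v hpv
    -- The local extension `G` replaces `F`, which lives only on `ker Ω`. The condition `0 < Ω` in
    -- `O` keeps the zero section, where `f` could vanish off the cone, out of the neighbourhood.
    set f : TangentBundle 𝓘(ℝ, E) M → ℝ := fun x =>
      Ω x.proj x.snd - G ⟨x.proj, kerProj Ω T h.unit x.proj x.snd⟩ with hf
    set O : Set (TangentBundle 𝓘(ℝ, E) M) := {x | 0 < Ω x.proj x.snd} ∩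
      (fun x : TangentBundle 𝓘(ℝ, E) M =>
        (⟨x.proj, kerProj Ω T h.unit x.proj x.snd⟩ : TangentBundle 𝓘(ℝ, E) M)) ⁻¹' U with hO
    have hOo : IsOpen O :=
      (isOpen_lt continuous_const hΩ.continuous).inter (hU.preimage hπ.continuous)
    have hvO : (⟨p, v⟩ : TangentBundle 𝓘(ℝ, E) M) ∈ O := ⟨hpos, hvU⟩
    have hfO : ContMDiffOn 𝓘(ℝ, E).tangent 𝓘(ℝ, ℝ) k f O :=
      hΩ.contMDiffOn.sub (hG.comp hπ.contMDiffOn fun x hx => hx.2)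
    have hmd : MDifferentiableAt 𝓘(ℝ, E).tangent 𝓘(ℝ, ℝ) f (⟨p, v⟩ : TangentBundle 𝓘(ℝ, E) M) :=
      (hfO.contMDiffAt (hOo.mem_nhds hvO)).mdifferentiableAt (fun h => by simp [h] at hk1)
    have hd : fderiv ℝ (fun x : E => f ⟨p, x⟩) v ≠ 0 := by
      have h1 : (fun x : E => f ⟨p, x⟩) =ᶠ[𝓝 v]
          fun x : E => (Ω p x : ℝ) - F p (kerProj Ω T h.unit p x) := by
        have hincl := (contMDiff_fiberInclusion (E := E) (k := k) p).continuous
        filter_upwards [hincl.continuousAt.preimage_mem_nhds (hOo.mem_nhds hvO)] with x hx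
        exact congrArg (fun t : ℝ => (Ω p x : ℝ) - t) (hGF p _ hx.2).symm
      rw [h1.fderiv_eq]
      have := ((hH p).isDefiningFunctionAt hk hpv).exists_contDiffOn.2
      exact this
    -- Regularity of `f` on `TM` follows from regularity along the fibre, which also gives
    -- transversality.
    refine ⟨f, ⟨⟨O, hOo, hvO, hfO, fun x hx => ?_⟩, fun h0 => hd ?_⟩, hd⟩
    · have hx0 : x.snd ≠ 0 := fun h0 => by
        have h1 : 0 < Ω x.proj x.snd := hx.1
        rw [h0, map_zero] at h1
        exact lt_irrefl _ h1
      have h1 : F x.proj (kerProj Ω T h.unit x.proj x.snd) =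
        G ⟨x.proj, kerProj Ω T h.unit x.proj x.snd⟩ := hGF x.proj _ hx.2
      rw [hf]
      simp only [graphCone, mem_ofPred_eq, ← h1, sub_eq_zero]
      exact ⟨fun h => h.2, fun h => ⟨hx0, h⟩⟩
    · ext u
      rw [fderiv_fiber_eq_comp hmd u, h0]
      rfl
  refine ⟨fun x hx => (key x.proj x.snd hx).imp fun f hf => hf.1, fun p w hw => ?_, fun p => ?_⟩
  · obtain ⟨f, hf, hd⟩ := key p w hw
    exact ⟨f, hf, (transverse_iff_fderiv_fiber_ne_zero (hf.mdifferentiableAt hk1) hf.2).2 hd⟩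
  · exact (hH p).isStrongCone hdim hk

/-- Uniqueness is immediate: the relation determines `C` off the zero section, and no cone contains
`0`. -/
theorem IsConeTriple.existsUnique_coneStructure (hdim : 2 ≤ Module.finrank ℝ E)
    [ContMDiffVectorBundle k E (TangentSpace 𝓘(ℝ, E) : M → Type _) 𝓘(ℝ, E)] (hk : 2 ≤ k)
    (h : IsConeTriple k Ω T F) :
    ∃! C : Set (TangentBundle 𝓘(ℝ, E) M),
      IsConeStructure k C ∧ IsAssociatedCone Ω T h.unit F C := by
  refine ⟨graphCone Ω T h.unit F, ⟨h.isConeStructure hdim hk, isAssociatedCone_graphCone h.unit⟩, ?_⟩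
  rintro C ⟨hC, hCF⟩
  ext ⟨p, v⟩
  by_cases hv : v = 0
  · subst hv
    exact iff_of_false (hC.strongCone p).zero_notMem fun h0 => h0.1 rfl
  · rw [hCF p v hv, isAssociatedCone_graphCone h.unit p v hv]

end Manifold

end ConeGeometry

theorem mainTheorem4 {E : Type*} [NormedAddCommGroup E] [NormedSpace ℝ E] [FiniteDimensional ℝ E]
    (hdim : 2 ≤ Module.finrank ℝ E)
    {M : Type*} [TopologicalSpace M] [ChartedSpace E M]
    (k : ℕ∞) (hk : 2 ≤ k)
    [IsManifold 𝓘(ℝ, E) 1 M] [IsManifold 𝓘(ℝ, E) ((k : ℕ∞ω) + 1) M] :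
    (∀ C : Set (TangentBundle 𝓘(ℝ, E) M), ConeGeometry.IsConeStructure k C →
      ∀ Ω : ∀ p : M, TangentSpace 𝓘(ℝ, E) p →L[ℝ] ℝ, ConeGeometry.IsTimelikeOneForm k C Ω →
      ∀ T : ∀ p : M, TangentSpace 𝓘(ℝ, E) p, ConeGeometry.IsTimelikeVectorField k C T →
      ∀ hT : ∀ p : M, Ω p (T p) = 1,
        ∃! F : ∀ p : M, ConeGeometry.kerFiber Ω p → ℝ,
          ConeGeometry.IsFinslerMetric k Ω F ∧ ConeGeometry.IsAssociatedCone Ω T hT F C) ∧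
    (∀ (Ω : ∀ p : M, TangentSpace 𝓘(ℝ, E) p →L[ℝ] ℝ) (T : ∀ p : M, TangentSpace 𝓘(ℝ, E) p)
      (F : ∀ p : M, ConeGeometry.kerFiber Ω p → ℝ) (h : ConeGeometry.IsConeTriple k Ω T F),
        ∃! C : Set (TangentBundle 𝓘(ℝ, E) M),
          ConeGeometry.IsConeStructure k C ∧ ConeGeometry.IsAssociatedCone Ω T h.unit F C) := by

  -- Passing to the tangent bundle costs one derivative, which is why `M` is of class `C^{k+1}`.
  have : ContMDiffVectorBundle k E (TangentSpace 𝓘(ℝ, E) : M → Type _) 𝓘(ℝ, E) :=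
    TangentBundle.contMDiffVectorBundle
  have : IsManifold 𝓘(ℝ, E) (k : ℕ∞ω) M :=
    IsManifold.of_le (n := (k : ℕ∞ω) + 1) le_self_add
  have hk' : (2 : ℕ∞ω) ≤ k := WithTop.coe_le_coe.2 hk
  exact ⟨fun C hC Ω hΩ T hTL hT => hC.existsUnique_finslerMetric hdim hk' hΩ hTL hT,
    fun Ω T F h => h.existsUnique_coneStructure hdim hk'⟩
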